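/- **Notation.** $\mathbb C\langle\langle X_0,X_1\rangle\rangle$ is the algebra of noncommutative formal power series; a series is written $\sum_w f(w)W$, the sum being over all words $w=\xi_{i_1}\cdots\xi_{i_r}$, where $W=X_{i_1}\cdots X_{i_r}$. It carries the coproduct with $\Delta(X_i)=1\otimes X_i+X_i\otimes 1$ and the counit $\varepsilon(X_i)=0$, and $F$ is *grouplike* if $\Delta(F)=F\,\widehat\otimes\,F$ and $\varepsilon(F)=1$. Holomorphy, derivatives and limits of series-valued functions are taken coefficientwise. Let $S=\mathbb C\langle\xi_0,\xi_1\rangle$ with the shuffle product ⧢, $S^0=\mathbb C1+S\xi_1$, $S^1=\mathbb C1+S\xi_0$, $S^{10}=\mathbb C1+\xi_0S\xi_1$. Then $S=S^0[\xi_0]=S^1[\xi_1]=S^{10}[\xi_0,\xi_1]$ as polynomial algebras, and $\mathrm{reg}^0,\mathrm{reg}^1,\mathrm{reg}^{10}$ denote the maps from $S$ to $S^0,S^1,S^{10}$ taking the constant term. For $w=\xi_0^{k_1-1}\xi_1\cdots\xi_0^{k_r-1}\xi_1\in S^{10}$ let $\zeta(w)=\sum_{n_1>\cdots>n_r>0}n_1^{-k_1}\cdots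 n_r^{-k_r}$, extended linearly to $S^{10}$ with $\zeta(1)=1$. The Drinfel'd associator is $$\Phi_{\rm KZ}=\Phi_{\rm KZ}(X_0,X_1)=\sum_w\zeta(\mathrm{reg}^{10}(w))\,W .$$ Let $D_0=\mathbb C\setminus[1,\infty)$ and $D_1=\mathbb C\setminus(-\infty,0]$; put $z^{\pm X_0}=\exp(\pm X_0\log z)$ and $(1-z)^{-X_1}=\exp(-X_1\log(1-z))$ with principal logarithms. The KZ equation of one variable is $\frac{dG}{dz}=\left(\frac{X_0}{z}+\frac{X_1}{1-z}\right)G$. The fundamental solution normalized at $z=0$ (resp. at $z=1$) is the solution on $D_0\cap D_1$ of the form $\widehat G(z)z^{X_0}$ with $\widehat G$ holomorphic at $0$ and $\widehat G(0)=1$ (resp. of the form $\widehat G(z)(1-z)^{-X_1}$ with $\widehat G$ holomorphic at $1$ and $\widehat G(1)=1$). **Theorem.** Assume the duality of the Drinfel'd associator, $\Phi_{\rm KZ}(X_0,X_1)=\Phi_{\rm KZ}(-X_1,-X_0)^{-1}$. Then there exists exactly one pair of $\mathbb C\langle\langle X_0,X_1\rangle\rangle$-valued functions of the form $$\widehat F^{(0)}(z)=\sum_w\widehat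 f^{(0)}(\mathrm{reg}^0(w);z)\,W,\qquad \widehat F^{(1)}(z)=\sum_w\widehat f^{(1)}(\mathrm{reg}^1(w);z)\,W,$$ with linear forms $\widehat f^{(0)}(\,\cdot\,;z)$ on $S^0$ $(z\in D_0)$ and $\widehat f^{(1)}(\,\cdot\,;z)$ on $S^1$ $(z\in D_1)$, which are holomorphic on $D_0$ and $D_1$ respectively, are grouplike, and satisfy: 1. $\left(\widehat F^{(1)}(z)\right)^{-1}\widehat F^{(0)}(z)=(1-z)^{-X_1}\,\Phi_{\rm KZ}\,z^{-X_0}$ for $z\in D_0\cap D_1$; 2. $\frac{d}{dz}\widehat F^{(i)}(z)\to 0$ as $z\to\infty$, $z\in D_i$, for $i=0,1$; 3. $\widehat F^{(0)}(0)=1$. Moreover, $\widehat F^{(0)}(z)\,z^{X_0}$ and $\widehat F^{(1)}(z)\,(1-z)^{-X_1}$ are the fundamental solutions of the KZ equation of one variable normalized at $z=0$ and $z=1$ respectively. -/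

import Mathlib

open Filter Topology

namespace KZ

/-! ### Noncommutative formal power series in two variables -/

/-- Words in the two letters `0`, `1`; the word `[i₁, …, iᵣ]` stands for `ξ_{i₁} ⋯ ξ_{iᵣ}`
and for its dual `X_{i₁} ⋯ X_{iᵣ}`. -/
abbrev Word := List (Fin 2)

/-- `R⟨⟨X₀, X₁⟩⟩`: formal power series `∑_w F(w) W` in two noncommuting variables which commute
with the coefficients; a series is the family of its coefficients. -/
def NCSeries (R : Type) : Type := Word → R

namespace NCSeries

theorem ext {R : Type} {F G : NCSeries R} (h : ∀ w, F w = G w) : F = G := funext h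

section ring

variable {R : Type} [Ring R]

instance : AddCommGroup (NCSeries R) := inferInstanceAs (AddCommGroup (Word → R))

/-- The constant series `1`. -/
instance : One (NCSeries R) := ⟨fun w => if w = [] then 1 else 0⟩

/-- The product of series: the coefficient of `w` in `F G` is `∑_{uv = w} F(u) G(v)`. -/
instance : Mul (NCSeries R) :=
  ⟨fun F G w => ∑ i ∈ Finset.range (w.length + 1), F (w.take i) * G (w.drop i)⟩

theorem add_apply (F G : NCSeries R) (w : Word) : (F + G) w = F w + G w := rfl

theorem zero_apply (w : Word) : (0 : NCSeries R) w = 0 := rfl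

theorem one_apply (w : Word) : (1 : NCSeries R) w = if w = [] then 1 else 0 := rfl

theorem mul_apply (F G : NCSeries R) (w : Word) :
    (F * G) w = ∑ i ∈ Finset.range (w.length + 1), F (w.take i) * G (w.drop i) := rfl

theorem mul_nil (F G : NCSeries R) : (F * G) [] = F [] * G [] := by
  simp [mul_apply]

/-- The series `∑_w F(a w) W`. -/
def tail (a : Fin 2) (F : NCSeries R) : NCSeries R := fun w => F (a :: w)

theorem mul_cons (F G : NCSeries R) (a : Fin 2) (w : Word) :
    (F * G) (a :: w) = F [] * G (a :: w) + (tail a F * G) w := by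
  rw [mul_apply, mul_apply, List.length_cons, Finset.sum_range_succ']
  simp [add_comm, tail]

theorem add_mul' (F G H : NCSeries R) : (F + G) * H = F * H + G * H :=
  ext fun w => by simp [mul_apply, add_apply, add_mul, Finset.sum_add_distrib]

/-- The series `r F`. -/
def scale (r : R) (F : NCSeries R) : NCSeries R := fun w => r * F w

theorem scale_mul (r : R) (F G : NCSeries R) : scale r F * G = scale r (F * G) :=
  ext fun w => by
    simp [mul_apply, scale, Finset.mul_sum, mul_assoc]

theorem mul_assoc' (F G H : NCSeries R) : F * G * H = F * (G * H) := by
  refine ext fun w => ?_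
  induction w generalizing F with
  | nil => simp [mul_nil, mul_assoc]
  | cons a w ih =>
    have e : tail a (F * G) = scale (F []) (tail a G) + tail a F * G :=
      ext fun u => mul_cons F G a u
    rw [mul_cons, mul_cons, e, add_mul', add_apply, ih, mul_nil, mul_cons G,
      scale_mul, scale, mul_add, mul_assoc, add_assoc]

instance : Ring (NCSeries R) where
  __ := (inferInstance : AddCommGroup (NCSeries R))
  mul_assoc := mul_assoc'
  one_mul F := ext fun w => by
    cases w with
    | nil => simp [mul_nil, one_apply]
    | cons a w =>
      have h : tail a (1 : NCSeries R) = 0 := ext fun u => by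
        simp [tail, one_apply, zero_apply]
      rw [mul_cons, h]
      simp [one_apply, mul_apply, zero_apply]
  mul_one F := ext fun w => by
    induction w generalizing F with
    | nil => simp [mul_nil, one_apply]
    | cons a w ih => rw [mul_cons, ih]; simp [one_apply, tail]
  left_distrib F G H := ext fun w => by
    simp [mul_apply, add_apply, mul_add, Finset.sum_add_distrib]
  right_distrib := add_mul'
  zero_mul F := ext fun w => by simp [mul_apply, zero_apply]
  mul_zero F := ext fun w => by simp [mul_apply, zero_apply]

instance {k : Type} [Semiring k] [Module k R] : Module k (NCSeries R) :=
  inferInstanceAs (Module k (Word → R))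

/-- The variables `X₀`, `X₁`. -/
def X (i : Fin 2) : NCSeries R := fun w => if w = [i] then 1 else 0

end ring

/-- `F(a₀, a₁)`: substitution `X_i ↦ a_i` in `F = ∑_w F(w) W`, for series `a₀, a₁` without
constant term (so that words longer than `w` do not contribute to the coefficient of `w`). -/
noncomputable def subst (a : Fin 2 → NCSeries ℂ) (F : NCSeries ℂ) : NCSeries ℂ :=
  fun w => ∑ n ∈ Finset.range (w.length + 1), ∑ v : Fin n → Fin 2,
    F (List.ofFn v) * (List.ofFn fun k => a (v k)).prod w

/-- `exp(a) = ∑ₙ aⁿ / n!` for a series `a` without constant term (so that `aⁿ` does not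
contribute to the coefficient of `w` for `n > |w|`). -/
noncomputable def exp (a : NCSeries ℂ) : NCSeries ℂ :=
  fun w => ∑ n ∈ Finset.range (w.length + 1), (a ^ n) w / (n.factorial : ℂ)

/-- `g ⊗ h` in the completed tensor square of `ℂ⟨⟨X₀, X₁⟩⟩`. That completed tensor square, whose
elements are the families of coefficients of the `U ⊗ V`, is `R⟨⟨X₀, X₁⟩⟩` with
`R = ℂ⟨⟨X₀, X₁⟩⟩`: the coefficient of `U ⊗ V` in `T` is `T u v`. -/
noncomputable def tmul (g h : NCSeries ℂ) : NCSeries (NCSeries ℂ) := fun u => g u • h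

/-- The coproduct on a word: the algebra morphism with `Δ(X_i) = 1 ⊗ X_i + X_i ⊗ 1`. -/
noncomputable def comulWord (w : Word) : NCSeries (NCSeries ℂ) :=
  (w.map fun i => tmul 1 (X i) + tmul (X i) 1).prod

/-- The coproduct `Δ(F) = ∑_w F(w) Δ(W)`. As `Δ(W)` is homogeneous of degree `|w|`, only the
words of length `|u| + |v|` contribute to the coefficient of `U ⊗ V`. -/
noncomputable def comul (F : NCSeries ℂ) : NCSeries (NCSeries ℂ) := fun u v =>
  ∑ w : Fin (u.length + v.length) → Fin 2, F (List.ofFn w) * comulWord (List.ofFn w) u v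

/-- `F` is grouplike: `ε(F) = 1` and `Δ(F) = F ⊗ F`. -/
def IsGrouplike (F : NCSeries ℂ) : Prop := F [] = 1 ∧ comul F = tmul F F

end NCSeries

/-! ### The shuffle algebra -/

/-- The underlying space of the shuffle algebra `S = S(ξ₀, ξ₁)`: linear combinations of words. -/
def Shuffle : Type := Word →₀ ℂ

namespace Shuffle

noncomputable instance : AddCommGroup Shuffle := inferInstanceAs (AddCommGroup (Word →₀ ℂ))

noncomputable instance : Module ℂ Shuffle := inferInstanceAs (Module ℂ (Word →₀ ℂ))

/-- A word as an element of `S`. -/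
noncomputable def word (w : Word) : Shuffle := Finsupp.single w (1 : ℂ)

/-- The linear map on `S` with given values on words. -/
noncomputable def extend {M : Type} [AddCommGroup M] [Module ℂ M] (f : Word → M) :
    Shuffle →ₗ[ℂ] M :=
  Finsupp.linearCombination ℂ f

@[simp] theorem extend_word {M : Type} [AddCommGroup M] [Module ℂ M] (f : Word → M) (w : Word) :
    extend f (word w) = f w := by
  have h := Finsupp.linearCombination_single ℂ (v := f) (1 : ℂ) w
  rw [one_smul] at h
  exact h

theorem hom_ext {M : Type} [AddCommGroup M] [Module ℂ M] {f g : Shuffle →ₗ[ℂ] M}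
    (h : ∀ w, f (word w) = g (word w)) : f = g :=
  Finsupp.lhom_ext' (M := ℂ) (N := M) fun w => LinearMap.ext_ring (h w)

/-- Left multiplication by the letter `ξ_a` for the concatenation of words. -/
noncomputable def prepend (a : Fin 2) : Shuffle →ₗ[ℂ] Shuffle := extend fun w => word (a :: w)

/-- The shuffle product of two words. -/
noncomputable def shuffleWord : Word → Word → Shuffle
  | [], w => word w
  | a :: u, [] => word (a :: u)
  | a :: u, b :: v =>
    prepend a (shuffleWord u (b :: v)) + prepend b (shuffleWord (a :: u) v)

/-- The shuffle product as a bilinear map. -/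
noncomputable def mulL : Shuffle →ₗ[ℂ] Shuffle →ₗ[ℂ] Shuffle :=
  extend fun u => extend fun v => shuffleWord u v

noncomputable instance : One Shuffle := ⟨word []⟩

noncomputable instance : Mul Shuffle := ⟨fun f g => mulL f g⟩

theorem one_def : (1 : Shuffle) = word [] := rfl

theorem mul_def (f g : Shuffle) : f * g = mulL f g := rfl

theorem word_mul_word (u v : Word) : word u * word v = shuffleWord u v := by
  simp [mul_def, mulL]

theorem shuffleWord_nil (u : Word) : shuffleWord u [] = word u := by
  cases u <;> simp [shuffleWord]

theorem shuffleWord_comm (u v : Word) : shuffleWord u v = shuffleWord v u := by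
  induction u generalizing v with
  | nil => rw [shuffleWord_nil, shuffleWord]
  | cons a u ihu =>
    induction v with
    | nil => rw [shuffleWord_nil, shuffleWord]
    | cons b v ihv => rw [shuffleWord, shuffleWord, ihu, ihv, add_comm]

theorem mulL_comm (f g : Shuffle) : mulL f g = mulL g f := by
  have h : mulL = mulL.flip := hom_ext fun u => hom_ext fun v => by
    simpa [mulL] using shuffleWord_comm u v
  exact congrArg (fun m => m f g) h

theorem mulL_one (f : Shuffle) : mulL f (word []) = f := by
  have h : mulL.flip (word []) = LinearMap.id := hom_ext fun u => by
    simpa [mulL] using shuffleWord_nil u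
  exact congrArg (fun m => m f) h

theorem mulL_prepend (a b : Fin 2) (f g : Shuffle) :
    mulL (prepend a f) (prepend b g) =
      prepend a (mulL f (prepend b g)) + prepend b (mulL (prepend a f) g) := by
  have h : (mulL.compl₂ (prepend b)) ∘ₗ prepend a =
      (mulL.compl₂ (prepend b)).compr₂ (prepend a) +
        (mulL ∘ₗ prepend a).compr₂ (prepend b) :=
    hom_ext fun u => hom_ext fun v => by simp [mulL, prepend, shuffleWord]
  exact congrArg (fun m => m f g) h

theorem mulL_assoc_word (u v w : Word) :
    mulL (mulL (word u) (word v)) (word w) = mulL (word u) (mulL (word v) (word w)) := by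
  induction u generalizing v w with
  | nil => rw [mulL_comm (word []), mulL_one, mulL_comm (word []), mulL_one]
  | cons a u ihu =>
    induction v generalizing w with
    | nil => rw [mulL_one, mulL_comm (word []), mulL_one]
    | cons b v ihv =>
      induction w with
      | nil => rw [mulL_one, mulL_one]
      | cons c w ihw =>
        have p : ∀ (x : Fin 2) (s : Word), word (x :: s) = prepend x (word s) := fun x s => by
          simp [prepend]
        have ihu1 := ihu (b :: v) (c :: w)
        have ihv1 := ihv (c :: w)
        simp only [p] at ihu1 ihv1 ihw ⊢
        rw [mulL_prepend a b, map_add, LinearMap.add_apply, mulL_prepend a c, mulL_prepend b c,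
          mulL_prepend b c, map_add, mulL_prepend a b, mulL_prepend a c, ihu1, ihv1, ← ihw,
          mulL_prepend a b (word u) (word v), mulL_prepend b c (word v) (word w)]
        simp only [map_add, LinearMap.add_apply]
        abel

theorem mulL_assoc (f g h : Shuffle) : mulL (mulL f g) h = mulL f (mulL g h) := by
  have h1 : ∀ (u v : Word) (h : Shuffle),
      mulL (mulL (word u) (word v)) h = mulL (word u) (mulL (word v) h) := fun u v h => by
    have e : mulL (mulL (word u) (word v)) = mulL (word u) ∘ₗ mulL (word v) :=
      hom_ext fun w => mulL_assoc_word u v w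
    exact congrArg (fun m => m h) e
  have h2 : ∀ (u : Word) (g h : Shuffle),
      mulL (mulL (word u) g) h = mulL (word u) (mulL g h) := fun u g h => by
    have e : mulL.flip h ∘ₗ mulL (word u) = mulL (word u) ∘ₗ mulL.flip h :=
      hom_ext fun v => h1 u v h
    exact congrArg (fun m => m g) e
  have e : mulL.flip h ∘ₗ mulL.flip g = mulL.flip (mulL g h) := hom_ext fun u => h2 u g h
  exact congrArg (fun m => m f) e

/-- The shuffle algebra as a commutative ring. -/
noncomputable instance : CommRing Shuffle where
  __ := (inferInstance : AddCommGroup Shuffle)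
  mul_assoc := mulL_assoc
  mul_comm := mulL_comm
  one_mul f := (mulL_comm _ _).trans (mulL_one f)
  mul_one := mulL_one
  left_distrib f g h := map_add (mulL f) g h
  right_distrib f g h := congrArg (fun m => m h) (map_add mulL f g)
  zero_mul f := congrArg (fun m => m f) (map_zero mulL)
  mul_zero f := map_zero (mulL f)

/-! ### The regularizing maps -/

/-- `S⁰ = ℂ1 + S ξ₁`. -/
noncomputable def S0 : Submodule ℂ Shuffle := Submodule.span ℂ (word '' {w | w = [] ∨ ∃ u, w = u ++ [1]})

/-- `S¹ = ℂ1 + S ξ₀`. -/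
noncomputable def S1 : Submodule ℂ Shuffle := Submodule.span ℂ (word '' {w | w = [] ∨ ∃ u, w = u ++ [0]})

/-- `S¹⁰ = ℂ1 + ξ₀ S ξ₁`. -/
noncomputable def S10 : Submodule ℂ Shuffle :=
  Submodule.span ℂ (word '' {w | w = [] ∨ ∃ u, w = 0 :: (u ++ [1])})

/-- The linear map removing a last letter `ξ_a` from words: `u ξ_a ↦ u`, other words `↦ 0`. -/
noncomputable def stripLast (a : Fin 2) : Shuffle →ₗ[ℂ] Shuffle :=
  extend fun w => if w.getLast? = some a then word w.dropLast else 0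

/-- The linear map removing a first letter `ξ_a` from words: `ξ_a u ↦ u`, other words `↦ 0`. -/
noncomputable def stripFirst (a : Fin 2) : Shuffle →ₗ[ℂ] Shuffle :=
  extend fun w => if w.head? = some a then word w.tail else 0

/-- `w ↦ ∑_j (-1)^j D^j(w) ⧢ ξ_a^j` for words `w`, extended linearly. -/
noncomputable def regWith (D : Shuffle →ₗ[ℂ] Shuffle) (a : Fin 2) : Shuffle →ₗ[ℂ] Shuffle :=
  extend fun w => ∑ j ∈ Finset.range (w.length + 1),
    (-1 : ℂ) ^ j • ((D ^ j) (word w) * word (List.replicate j a))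

/-- `reg⁰ : S = S⁰[ξ₀] → S⁰`, the constant term of a polynomial in `ξ₀` over `S⁰`
(see `reg0_eq_iff`), by the formula `reg⁰(u ξ₀ⁿ) = ∑_j (-1)^j (u ξ₀^{n-j}) ⧢ ξ₀^j`. -/
noncomputable def reg0 : Shuffle →ₗ[ℂ] Shuffle := regWith (stripLast 0) 0

/-- `reg¹ : S = S¹[ξ₁] → S¹`, the constant term of a polynomial in `ξ₁` over `S¹`
(see `reg1_eq_iff`). -/
noncomputable def reg1 : Shuffle →ₗ[ℂ] Shuffle := regWith (stripLast 1) 1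

/-- `reg¹⁰ : S = S¹⁰[ξ₀, ξ₁] → S¹⁰`, the constant term of a polynomial in `ξ₀`, `ξ₁` over `S¹⁰`
(see `reg10_eq_iff`). -/
noncomputable def reg10 : Shuffle →ₗ[ℂ] Shuffle := regWith (stripFirst 1) 1 ∘ₗ reg0

theorem prepend_word (a : Fin 2) (w : Word) : prepend a (word w) = word (a :: w) := by
  simp [prepend]

theorem smul_mul (c : ℂ) (f g : Shuffle) : (c • f) * g = c • (f * g) :=
  congrArg (fun m => m g) (map_smul mulL c f)

theorem mul_smul' (c : ℂ) (f g : Shuffle) : f * (c • g) = c • (f * g) :=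
  map_smul (mulL f) c g

theorem prepend_mul_prepend (a b : Fin 2) (f g : Shuffle) :
    prepend a f * prepend b g = prepend a (f * prepend b g) + prepend b (prepend a f * g) :=
  mulL_prepend a b f g

/-- Leibniz rules extend from words to `S`. -/
theorem leibniz_of_word (D : Shuffle →ₗ[ℂ] Shuffle)
    (h : ∀ u v, D (word u * word v) = D (word u) * word v + word u * D (word v))
    (f g : Shuffle) : D (f * g) = D f * g + f * D g := by
  have e : mulL.compr₂ D = mulL ∘ₗ D + mulL.compl₂ D :=
    hom_ext fun u => hom_ext fun v => h u v
  exact congrArg (fun m => m f g) e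

theorem stripFirst_prepend (a b : Fin 2) (f : Shuffle) :
    stripFirst a (prepend b f) = if b = a then f else 0 := by
  have e : stripFirst a ∘ₗ prepend b = if b = a then LinearMap.id else 0 :=
    hom_ext fun w => by
      by_cases h : b = a <;> simp [stripFirst, prepend, h]
  have := congrArg (fun m => m f) e
  by_cases h : b = a <;> simpa [h] using this

theorem stripFirst_one (a : Fin 2) : stripFirst a 1 = 0 := by simp [one_def, stripFirst]

theorem stripLast_one (a : Fin 2) : stripLast a 1 = 0 := by simp [one_def, stripLast]

theorem stripFirst_mul (a : Fin 2) (f g : Shuffle) :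
    stripFirst a (f * g) = stripFirst a f * g + f * stripFirst a g := by
  refine leibniz_of_word _ (fun u v => ?_) f g
  cases u with
  | nil => rw [← one_def, one_mul, one_mul, stripFirst_one, zero_mul, zero_add]
  | cons b u =>
    cases v with
    | nil => rw [← one_def, mul_one, mul_one, stripFirst_one, mul_zero, add_zero]
    | cons c v =>
      simp only [← prepend_word]
      rw [prepend_mul_prepend, map_add]
      simp only [stripFirst_prepend]
      split_ifs <;> simp

/-- The coefficient of the empty word. -/
noncomputable def counit : Shuffle →ₗ[ℂ] ℂ := extend fun w => if w = [] then 1 else 0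

theorem counit_prepend (a : Fin 2) (f : Shuffle) : counit (prepend a f) = 0 := by
  have e : counit ∘ₗ prepend a = 0 := hom_ext fun w => by simp [counit, prepend]
  exact congrArg (fun m => m f) e

theorem counit_mul_prepend (a : Fin 2) (w : Word) (f : Shuffle) :
    counit (word w * prepend a f) = 0 := by
  cases w with
  | nil => rw [← one_def, one_mul, counit_prepend]
  | cons b w => rw [← prepend_word, prepend_mul_prepend, map_add, counit_prepend,
      counit_prepend, add_zero]

theorem stripLast_prepend (a b : Fin 2) (f : Shuffle) :
    stripLast a (prepend b f) =
      prepend b (stripLast a f) + if b = a then counit f • (1 : Shuffle) else 0 := by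
  have e : stripLast a ∘ₗ prepend b = prepend b ∘ₗ stripLast a +
      if b = a then counit.smulRight (1 : Shuffle) else 0 := hom_ext fun w => by
    by_cases h : b = a
    · subst h
      cases w with
      | nil => simp [stripLast, prepend, counit, one_def]
      | cons c w =>
        by_cases h' : (c :: w).getLast? = some b <;>
          simp [stripLast, prepend, counit, h', List.getLast?_cons_cons]
    · cases w with
      | nil => simp [stripLast, prepend, h]
      | cons c w =>
        by_cases h' : (c :: w).getLast? = some a <;>
          simp [stripLast, prepend, h, h', List.getLast?_cons_cons]
  have := congrArg (fun m => m f) e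
  by_cases h : b = a <;> simpa [h] using this

theorem stripLast_mul (a : Fin 2) (f g : Shuffle) :
    stripLast a (f * g) = stripLast a f * g + f * stripLast a g := by
  refine leibniz_of_word _ (fun u v => ?_) f g
  induction u generalizing v with
  | nil => rw [← one_def, one_mul, one_mul, stripLast_one, zero_mul, zero_add]
  | cons b u ihu =>
    induction v with
    | nil => rw [← one_def, mul_one, mul_one, stripLast_one, mul_zero, add_zero]
    | cons c v ihv =>
      have ihu1 := ihu (c :: v)
      have k1 := counit_mul_prepend c u (word v)
      have k2 := counit_mul_prepend b v (word u)
      simp only [← prepend_word] at ihu1 ihv ⊢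
      rw [mul_comm] at k2
      rw [prepend_mul_prepend, map_add, stripLast_prepend a b (word u * _), ihu1, k1,
        stripLast_prepend a c (_ * word v), ihv, k2,
        stripLast_prepend a b (word u), stripLast_prepend a c (word v)]
      simp only [zero_smul, ite_self, add_zero, map_add, add_mul, mul_add,
        prepend_mul_prepend]
      split_ifs <;> simp only [smul_mul, mul_smul', one_mul, mul_one, map_smul, map_zero,
        zero_mul, mul_zero, add_zero] <;> abel

theorem replicate_mul (a : Fin 2) (i j : ℕ) :
    word (List.replicate i a) * word (List.replicate j a) =
      ((i + j).choose i : ℂ) • word (List.replicate (i + j) a) := by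
  induction i generalizing j with
  | zero => simp [← one_def]
  | succ i ihi =>
    induction j with
    | zero => simp [← one_def]
    | succ j ihj =>
      have h1 := ihi (j + 1)
      simp only [List.replicate_succ, ← prepend_word] at h1 ihj ⊢
      rw [prepend_mul_prepend, h1, ihj]
      have e1 : i + (j + 1) = i + j + 1 := by omega
      have e2 : i + 1 + j = i + j + 1 := by omega
      have e3 : i + 1 + (j + 1) = i + j + 1 + 1 := by omega
      simp only [e1, e2, e3, List.replicate_succ, ← prepend_word, map_smul]
      rw [← add_smul, Nat.choose_succ_succ (i + j + 1) i, Nat.cast_add]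

/-- A locally nilpotent derivation `D` of `S` for which `ξ_a` is a slice. -/
structure IsSlice (D : Shuffle →ₗ[ℂ] Shuffle) (a : Fin 2) : Prop where
  leibniz : ∀ f g, D (f * g) = D f * g + f * D g
  one : D 1 = 0
  succ : ∀ j, D (word (List.replicate (j + 1) a)) = word (List.replicate j a)
  nilp : ∀ w : Word, (D ^ (w.length + 1)) (word w) = 0

theorem isSlice_stripLast (a : Fin 2) : IsSlice (stripLast a) a where
  leibniz := stripLast_mul a
  one := stripLast_one a
  succ j := by
    simp [stripLast, List.getLast?_replicate]
  nilp w := by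
    induction w using List.reverseRecOn with
    | nil => simpa [one_def] using stripLast_one a
    | append_singleton w b ih =>
      rw [List.length_append, List.length_singleton, pow_succ, Module.End.mul_apply]
      by_cases h : b = a <;> simp [stripLast, h] at ih ⊢
      exact ih

theorem isSlice_stripFirst (a : Fin 2) : IsSlice (stripFirst a) a where
  leibniz := stripFirst_mul a
  one := stripFirst_one a
  succ j := by
    simp [stripFirst, List.replicate_succ]
  nilp w := by
    induction w with
    | nil => simpa [one_def] using stripFirst_one a
    | cons b w ih =>
      rw [List.length_cons, pow_succ, Module.End.mul_apply, ← prepend_word, stripFirst_prepend]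
      by_cases h : b = a <;> simp [h, ih]

namespace IsSlice

variable {D : Shuffle →ₗ[ℂ] Shuffle} {a : Fin 2}

theorem pow_eq_zero_of_le {f : Shuffle} {m n : ℕ} (hmn : m ≤ n) (h : (D ^ m) f = 0) :
    (D ^ n) f = 0 := by
  obtain ⟨k, rfl⟩ := Nat.exists_eq_add_of_le' hmn
  rw [pow_add, Module.End.mul_apply, h, map_zero]

theorem pow_mul (hD : IsSlice D a) {c : Shuffle} (hc : D c = 0) (x : Shuffle) (n : ℕ) :
    (D ^ n) (c * x) = c * (D ^ n) x := by
  induction n with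
  | zero => simp
  | succ n ih =>
    rw [pow_succ', Module.End.mul_apply, Module.End.mul_apply, ih, hD.leibniz, hc, zero_mul,
      zero_add]

theorem pow_replicate (hD : IsSlice D a) (j n : ℕ) :
    (D ^ n) (word (List.replicate (n + j) a)) = word (List.replicate j a) := by
  induction n with
  | zero => simp
  | succ n ih =>
    have e : n + 1 + j = n + j + 1 := by omega
    rw [pow_succ, Module.End.mul_apply, e, hD.succ, ih]

theorem pow_replicate_of_lt (hD : IsSlice D a) {j n : ℕ} (h : j < n) :
    (D ^ n) (word (List.replicate j a)) = 0 :=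
  pow_eq_zero_of_le (Nat.succ_le_of_lt h) (by simpa using hD.nilp (List.replicate j a))

theorem induction_word {p : Shuffle → Prop} (f : Shuffle) (h0 : p 0)
    (h : ∀ (w : Word) (c : ℂ) (g : Shuffle), p g → p (c • word w + g)) : p f := by
  refine Finsupp.induction (motive := p) f h0 fun w c g _ _ hg => ?_
  have e : c • word w = (Finsupp.single w c : Word →₀ ℂ) := by
    have := Finsupp.smul_single c w (1 : ℂ)
    rw [smul_eq_mul, mul_one] at this
    exact this
  rw [← e]
  exact h w c g hg

theorem exists_nilp (hD : IsSlice D a) (f : Shuffle) : ∃ n, (D ^ (n + 1)) f = 0 := by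
  refine induction_word (p := fun f => ∃ n, (D ^ (n + 1)) f = 0) f ⟨0, by simp⟩
    fun w c g ⟨n, hn⟩ => ⟨max w.length n, ?_⟩
  rw [map_add, map_smul, pow_eq_zero_of_le (by omega) (hD.nilp w),
    pow_eq_zero_of_le (by omega) hn, smul_zero, add_zero]

/-- Every element is a polynomial in `ξ_a` with coefficients in `ker D`. -/
theorem exists_decomp (hD : IsSlice D a) (K : Submodule ℂ Shuffle)
    (hKD : ∀ f ∈ K, D f ∈ K) (hKx : ∀ f ∈ K, ∀ j, f * word (List.replicate j a) ∈ K)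
    (n : ℕ) (f : Shuffle) (hf : f ∈ K) (hn : (D ^ n) f = 0) :
    ∃ c : ℕ → Shuffle, (∀ j, D (c j) = 0 ∧ c j ∈ K) ∧
      f = ∑ j ∈ Finset.range n, c j * word (List.replicate j a) := by
  induction n generalizing f with
  | zero => exact ⟨0, fun j => by simp, by simpa using hn⟩
  | succ n ih =>
    have hKn : ∀ m, (D ^ m) f ∈ K := fun m => by
      induction m with
      | zero => simpa using hf
      | succ m ihm => rw [pow_succ', Module.End.mul_apply]; exact hKD _ ihm
    have hg : D ((D ^ n) f) = 0 := by rw [← Module.End.mul_apply, ← pow_succ', hn]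
    obtain ⟨c, hc, hs⟩ := ih (f - (D ^ n) f * word (List.replicate n a))
      (K.sub_mem hf (hKx _ (hKn n) n)) (by
        rw [map_sub, hD.pow_mul hg]
        have := hD.pow_replicate 0 n
        rw [add_zero] at this
        rw [this, List.replicate_zero, ← one_def, mul_one, sub_self])
    refine ⟨fun j => if j = n then (D ^ n) f else c j, fun j => ?_, ?_⟩
    · by_cases h : j = n
      · simpa [h] using ⟨hg, hKn n⟩
      · simpa [h] using hc j
    · rw [Finset.sum_range_succ]
      simp only [if_true]
      rw [← sub_eq_iff_eq_add, hs]
      refine Finset.sum_congr rfl fun j hj => ?_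
      rw [if_neg (Finset.mem_range.mp hj).ne]

theorem regWith_eq (hD : IsSlice D a) (f : Shuffle) : ∃ n, ∀ m, n ≤ m →
    regWith D a f =
      ∑ j ∈ Finset.range (m + 1), (-1 : ℂ) ^ j • ((D ^ j) f * word (List.replicate j a)) := by
  refine induction_word (p := fun f => ∃ n, ∀ m, n ≤ m → regWith D a f =
    ∑ j ∈ Finset.range (m + 1), (-1 : ℂ) ^ j • ((D ^ j) f * word (List.replicate j a))) f
    ⟨0, fun m _ => by simp⟩ fun w c g ⟨n, hn⟩ => ⟨max w.length n, fun m hm => ?_⟩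
  have hw : regWith D a (word w) = ∑ j ∈ Finset.range (m + 1),
      (-1 : ℂ) ^ j • ((D ^ j) (word w) * word (List.replicate j a)) := by
    rw [regWith, extend_word]
    refine Finset.sum_subset (Finset.range_mono (by omega)) fun j _ hj => ?_
    rw [Finset.mem_range, not_lt] at hj
    rw [pow_eq_zero_of_le hj (hD.nilp w), zero_mul, smul_zero]
  rw [map_add, map_smul, hw, hn m (by omega), Finset.smul_sum, ← Finset.sum_add_distrib]
  refine Finset.sum_congr rfl fun j _ => ?_
  rw [map_add, map_smul, add_mul, smul_mul, smul_add, smul_comm]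

theorem regWith_mul_replicate (hD : IsSlice D a) {c : Shuffle} (hc : D c = 0) (k : ℕ) :
    regWith D a (c * word (List.replicate k a)) = if k = 0 then c else 0 := by
  obtain ⟨n, hn⟩ := hD.regWith_eq (c * word (List.replicate k a))
  rw [hn (max n k) (le_max_left _ _)]
  have h1 : ∑ j ∈ Finset.range (max n k + 1), (-1 : ℂ) ^ j •
      ((D ^ j) (c * word (List.replicate k a)) * word (List.replicate j a)) =
      ∑ j ∈ Finset.range (k + 1), (-1 : ℂ) ^ j •
      ((D ^ j) (c * word (List.replicate k a)) * word (List.replicate j a)) := by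
    symm
    refine Finset.sum_subset (Finset.range_mono (by omega)) fun j _ hj => ?_
    rw [Finset.mem_range, not_lt] at hj
    rw [hD.pow_mul hc, hD.pow_replicate_of_lt (by omega), mul_zero, zero_mul, smul_zero]
  have h2 : ∀ j ∈ Finset.range (k + 1), (-1 : ℂ) ^ j •
      ((D ^ j) (c * word (List.replicate k a)) * word (List.replicate j a)) =
      ((-1 : ℂ) ^ j * (k.choose j : ℂ)) • (c * word (List.replicate k a)) := fun j hj => by
    obtain ⟨i, rfl⟩ := Nat.exists_eq_add_of_le (Nat.lt_succ_iff.mp (Finset.mem_range.mp hj))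
    rw [hD.pow_mul hc, hD.pow_replicate, mul_assoc, replicate_mul, mul_smul', smul_smul,
      Nat.add_comm i j, Nat.choose_symm_add]
  rw [h1, Finset.sum_congr rfl h2, ← Finset.sum_smul]
  have h3 : ∑ j ∈ Finset.range (k + 1), (-1 : ℂ) ^ j * (k.choose j : ℂ) =
      if k = 0 then 1 else 0 := by
    have := Int.alternating_sum_range_choose (n := k)
    exact_mod_cast congrArg (Int.cast : ℤ → ℂ) this
  rw [h3]
  by_cases h : k = 0
  · subst h
    simp [← one_def]
  · simp [h]

theorem regWith_sum (hD : IsSlice D a) (n : ℕ) (c : ℕ → Shuffle) (hc : ∀ j, D (c j) = 0) :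
    regWith D a (∑ j ∈ Finset.range (n + 1), c j * word (List.replicate j a)) = c 0 := by
  rw [map_sum, Finset.sum_congr rfl fun j _ => hD.regWith_mul_replicate (hc j) j]
  simp

theorem regWith_eq_iff (hD : IsSlice D a) (u v : Shuffle) :
    regWith D a u = v ↔ ∃ (n : ℕ) (c : ℕ → Shuffle), (∀ j, D (c j) = 0) ∧
      u = ∑ j ∈ Finset.range (n + 1), c j * word (List.replicate j a) ∧ v = c 0 := by
  constructor
  · rintro rfl
    obtain ⟨n, hn⟩ := hD.exists_nilp u
    obtain ⟨c, hc, hs⟩ := hD.exists_decomp ⊤ (by simp) (by simp) (n + 1) u trivial hn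
    refine ⟨n, c, fun j => (hc j).1, hs, ?_⟩
    rw [hs, hD.regWith_sum n c fun j => (hc j).1]
  · rintro ⟨n, c, hc, rfl, rfl⟩
    exact hD.regWith_sum n c hc

end IsSlice

/-- The coefficient of a word. -/
noncomputable def coeff (w : Word) : Shuffle →ₗ[ℂ] ℂ := Finsupp.lapply w

theorem mem_span_of_coeff {p : Set Word} (f : Shuffle)
    (h : ∀ w, coeff w f ≠ 0 → w ∈ p) : f ∈ Submodule.span ℂ (word '' p) := by
  have h1 : f ∈ Finsupp.supported ℂ ℂ p :=
    (Finsupp.mem_supported ℂ _).mpr fun w hw => h w (Finsupp.mem_support_iff.mp hw)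
  rw [Finsupp.supported_eq_span_single] at h1
  exact h1

theorem coeff_word (w v : Word) : coeff w (word v) = if v = w then 1 else 0 :=
  Finsupp.single_apply

theorem coeff_stripLast (a : Fin 2) (w : Word) (f : Shuffle) :
    coeff w (stripLast a f) = coeff (w ++ [a]) f := by
  have e : coeff w ∘ₗ stripLast a = coeff (w ++ [a]) := hom_ext fun v => by
    rw [LinearMap.comp_apply, coeff_word, stripLast, extend_word]
    induction v using List.reverseRecOn with
    | nil => simp
    | append_singleton v b _ =>
      by_cases h : b = a <;> simp [h, coeff_word]
  exact congrArg (fun m => m f) e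

theorem coeff_stripFirst (a : Fin 2) (w : Word) (f : Shuffle) :
    coeff w (stripFirst a f) = coeff (a :: w) f := by
  have e : coeff w ∘ₗ stripFirst a = coeff (a :: w) := hom_ext fun v => by
    rw [LinearMap.comp_apply, coeff_word, stripFirst, extend_word]
    cases v with
    | nil => simp
    | cons b v => by_cases h : b = a <;> simp [h, coeff_word]
  exact congrArg (fun m => m f) e

theorem mem_S0_iff (f : Shuffle) : f ∈ S0 ↔ stripLast 0 f = 0 := by
  constructor
  · intro h
    refine Submodule.span_induction (p := fun f _ => stripLast 0 f = 0) ?_ (map_zero _)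
      (fun f g _ _ hf hg => by rw [map_add, hf, hg, add_zero])
      (fun c f _ hf => by rw [map_smul, hf, smul_zero]) h
    rintro _ ⟨w, rfl | ⟨u, rfl⟩, rfl⟩ <;> simp [stripLast]
  · refine fun h => mem_span_of_coeff f fun w hw => ?_
    induction w using List.reverseRecOn with
    | nil => exact Or.inl rfl
    | append_singleton w b _ =>
      refine Or.inr ⟨w, ?_⟩
      have h1 := coeff_stripLast 0 w f
      rw [h, map_zero] at h1
      have hb : b ≠ 0 := by
        rintro rfl
        exact hw h1.symm
      rw [show b = 1 by omega]

theorem mem_S1_iff (f : Shuffle) : f ∈ S1 ↔ stripLast 1 f = 0 := by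
  constructor
  · intro h
    refine Submodule.span_induction (p := fun f _ => stripLast 1 f = 0) ?_ (map_zero _)
      (fun f g _ _ hf hg => by rw [map_add, hf, hg, add_zero])
      (fun c f _ hf => by rw [map_smul, hf, smul_zero]) h
    rintro _ ⟨w, rfl | ⟨u, rfl⟩, rfl⟩ <;> simp [stripLast]
  · refine fun h => mem_span_of_coeff f fun w hw => ?_
    induction w using List.reverseRecOn with
    | nil => exact Or.inl rfl
    | append_singleton w b _ =>
      refine Or.inr ⟨w, ?_⟩
      have h1 := coeff_stripLast 1 w f
      rw [h, map_zero] at h1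
      have hb : b ≠ 1 := by
        rintro rfl
        exact hw h1.symm
      rw [show b = 0 by omega]

theorem mem_S10_iff (f : Shuffle) : f ∈ S10 ↔ stripFirst 1 f = 0 ∧ f ∈ S0 := by
  rw [mem_S0_iff]
  constructor
  · intro h
    refine Submodule.span_induction
      (p := fun f _ => stripFirst 1 f = 0 ∧ stripLast 0 f = 0) ?_ (by simp)
      (fun f g _ _ hf hg => by rw [map_add, map_add, hf.1, hg.1, hf.2, hg.2]; simp)
      (fun c f _ hf => by rw [map_smul, map_smul, hf.1, hf.2]; simp) h
    rintro _ ⟨w, rfl | ⟨u, rfl⟩, rfl⟩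
    · simp [stripLast, stripFirst]
    · constructor
      · simp [stripFirst]
      · rw [stripLast, extend_word, ← List.cons_append, List.getLast?_concat]
        simp
  · rintro ⟨h, h'⟩
    refine mem_span_of_coeff f fun w hw => ?_
    cases w with
    | nil => exact Or.inl rfl
    | cons a w =>
      have ha : a ≠ 1 := by
        rintro rfl
        have h1 := coeff_stripFirst 1 w f
        rw [h, map_zero] at h1
        exact hw h1.symm
      have ha' : a = 0 := by omega
      subst ha'
      refine Or.inr ?_
      have h2 : ∀ u b, 0 :: w = u ++ [b] → b = 1 := fun u b hu => by
        have h1 := coeff_stripLast 0 u f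
        rw [h', map_zero] at h1
        have hb : b ≠ 0 := by
          rintro rfl
          rw [hu] at hw
          exact hw h1.symm
        omega
      induction w using List.reverseRecOn with
      | nil => exact absurd (h2 [] 0 rfl) (by decide)
      | append_singleton w b _ =>
        exact ⟨w, by rw [h2 (0 :: w) b rfl]⟩

/-- `reg⁰(u)` is the constant term of `u` as a polynomial in `ξ₀` over `S⁰`. -/
theorem reg0_eq_iff (u v : Shuffle) :
    reg0 u = v ↔ ∃ (n : ℕ) (c : ℕ → Shuffle), (∀ j, c j ∈ S0) ∧
      u = ∑ j ∈ Finset.range (n + 1), c j * word (List.replicate j 0) ∧ v = c 0 := by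
  simp only [mem_S0_iff]
  exact (isSlice_stripLast 0).regWith_eq_iff u v

/-- `reg¹(u)` is the constant term of `u` as a polynomial in `ξ₁` over `S¹`. -/
theorem reg1_eq_iff (u v : Shuffle) :
    reg1 u = v ↔ ∃ (n : ℕ) (c : ℕ → Shuffle), (∀ j, c j ∈ S1) ∧
      u = ∑ j ∈ Finset.range (n + 1), c j * word (List.replicate j 1) ∧ v = c 0 := by
  simp only [mem_S1_iff]
  exact (isSlice_stripLast 1).regWith_eq_iff u v

theorem stripFirst_mem_S0 (f : Shuffle) (h : f ∈ S0) : stripFirst 1 f ∈ S0 := by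
  refine Submodule.span_induction (p := fun f _ => stripFirst 1 f ∈ S0) ?_ (by simp)
    (fun f g _ _ hf hg => by rw [map_add]; exact S0.add_mem hf hg)
    (fun c f _ hf => by rw [map_smul]; exact S0.smul_mem c hf) h
  rintro _ ⟨w, hw, rfl⟩
  rw [stripFirst, extend_word]
  split_ifs
  · refine Submodule.subset_span ⟨w.tail, ?_, rfl⟩
    rcases hw with rfl | ⟨u, rfl⟩
    · exact Or.inl rfl
    · cases u with
      | nil => exact Or.inl rfl
      | cons b u => exact Or.inr ⟨u, rfl⟩
  · exact S0.zero_mem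

theorem mul_mem_S0 (f g : Shuffle) (hf : f ∈ S0) (hg : g ∈ S0) : f * g ∈ S0 := by
  rw [mem_S0_iff] at *
  rw [stripLast_mul, hf, hg, zero_mul, mul_zero, add_zero]

theorem replicate_mem_S0 (j : ℕ) : word (List.replicate j 1) ∈ S0 := by
  refine Submodule.subset_span ⟨_, ?_, rfl⟩
  cases j with
  | zero => exact Or.inl rfl
  | succ j => exact Or.inr ⟨List.replicate j 1, List.replicate_succ'⟩

/-- `reg¹⁰(u)` is the constant term of `u` as a polynomial in `ξ₀`, `ξ₁` over `S¹⁰`. -/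
theorem reg10_eq_iff (u v : Shuffle) :
    reg10 u = v ↔ ∃ (m n : ℕ) (c : ℕ → ℕ → Shuffle), (∀ i j, c i j ∈ S10) ∧
      u = ∑ j ∈ Finset.range (n + 1), ∑ i ∈ Finset.range (m + 1),
        word (List.replicate i 1) * c i j * word (List.replicate j 0) ∧ v = c 0 0 := by
  have hD := isSlice_stripFirst 1
  have key : ∀ (m n : ℕ) (c : ℕ → ℕ → Shuffle), (∀ i j, c i j ∈ S10) →
      reg10 (∑ j ∈ Finset.range (n + 1), ∑ i ∈ Finset.range (m + 1),
        word (List.replicate i 1) * c i j * word (List.replicate j 0)) = c 0 0 := by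
    intro m n c hc
    have h0 : reg0 (∑ j ∈ Finset.range (n + 1), ∑ i ∈ Finset.range (m + 1),
        word (List.replicate i 1) * c i j * word (List.replicate j 0)) =
        ∑ i ∈ Finset.range (m + 1), c i 0 * word (List.replicate i 1) := by
      rw [reg0_eq_iff]
      refine ⟨n, fun j => ∑ i ∈ Finset.range (m + 1), c i j * word (List.replicate i 1),
        fun j => S0.sum_mem fun i _ =>
          mul_mem_S0 _ _ ((mem_S10_iff _).mp (hc i j)).2 (replicate_mem_S0 i), ?_, rfl⟩
      refine Finset.sum_congr rfl fun j _ => ?_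
      rw [Finset.sum_mul]
      exact Finset.sum_congr rfl fun i _ => by rw [mul_comm (c i j)]
    rw [reg10, LinearMap.comp_apply, h0]
    exact hD.regWith_sum m (fun i => c i 0) fun i => ((mem_S10_iff _).mp (hc i 0)).1
  constructor
  · rintro rfl
    obtain ⟨n, w, hw, hu, -⟩ := (reg0_eq_iff u _).mp rfl
    choose d hd using fun j => hD.exists_nilp (w j)
    set m := (Finset.range (n + 1)).sup d with hm
    have hex : ∀ j, ∃ c : ℕ → Shuffle, (∀ i, c i ∈ S10) ∧ (j ∈ Finset.range (n + 1) →
        w j = ∑ i ∈ Finset.range (m + 1), c i * word (List.replicate i 1)) := fun j => by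
      by_cases hj : j ∈ Finset.range (n + 1)
      · have hdj : d j ≤ m := Finset.le_sup hj
        obtain ⟨c, hc, hs⟩ := hD.exists_decomp S0 stripFirst_mem_S0
          (fun f hf j => mul_mem_S0 f _ hf (replicate_mem_S0 j)) (m + 1) (w j) (hw j)
          (IsSlice.pow_eq_zero_of_le (by omega) (hd j))
        exact ⟨c, fun i => (mem_S10_iff _).mpr (hc i), fun _ => hs⟩
      · exact ⟨0, fun i => S10.zero_mem, fun h => absurd h hj⟩
    choose c hc hs using hex
    have hu' : u = ∑ j ∈ Finset.range (n + 1), ∑ i ∈ Finset.range (m + 1),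
        word (List.replicate i 1) * c j i * word (List.replicate j 0) := by
      rw [hu]
      refine Finset.sum_congr rfl fun j hj => ?_
      rw [hs j hj, Finset.sum_mul]
      exact Finset.sum_congr rfl fun i _ => by rw [mul_comm (c j i)]
    refine ⟨m, n, fun i j => c j i, fun i j => hc j i, hu', ?_⟩
    conv_lhs => rw [hu']
    exact key m n (fun i j => c j i) fun i j => hc j i
  · rintro ⟨m, n, c, hc, rfl, rfl⟩
    exact key m n c hc

end Shuffle
/-! ### Multiple zeta values and the associator -/

/-- The exponents `[k₁, …, kᵣ]` of the word `ξ₀^{k₁-1} ξ₁ ⋯ ξ₀^{kᵣ-1} ξ₁`. (Only words which are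
empty or end in `ξ₁` are of this form; the values at other words are not used.) -/
def exponents : Word → List ℕ
  | [] => []
  | 0 :: w => (exponents w).modifyHead (· + 1)
  | 1 :: w => 1 :: exponents w

/-- The multiple zeta value `ζ(k₁, …, kᵣ) = ∑_{n₁ > ⋯ > nᵣ > 0} 1 / (n₁^{k₁} ⋯ nᵣ^{kᵣ})`. -/
noncomputable def mzv (k : List ℕ) : ℂ :=
  ∑' n : {n : Fin k.length → ℕ // StrictAnti n ∧ ∀ i, 0 < n i},
    ∏ i, 1 / (n.1 i : ℂ) ^ k.get i

/-- `ζ` on words, extended linearly; it is only evaluated on `S¹⁰`. -/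
noncomputable def zeta : Shuffle →ₗ[ℂ] ℂ := Shuffle.extend fun w => mzv (exponents w)

/-- The Drinfel'd associator `Φ_KZ(X₀, X₁) = ∑_w ζ(reg¹⁰(w)) W`. -/
noncomputable def PhiKZ : NCSeries ℂ := fun w => zeta (Shuffle.reg10 (Shuffle.word w))

/-! ### Functions with values in `ℂ⟨⟨X₀, X₁⟩⟩` -/

open NCSeries

/-- `D₀ = ℂ ∖ {x ∈ ℝ | x ≥ 1}`. -/
def D0 : Set ℂ := {z | ¬ ∃ x : ℝ, 1 ≤ x ∧ z = x}

/-- `D₁ = ℂ ∖ {x ∈ ℝ | x ≤ 0}`. -/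
def D1 : Set ℂ := {z | ¬ ∃ x : ℝ, x ≤ 0 ∧ z = x}

/-- `z^{X₀} = exp(X₀ log z)`, with the principal logarithm. -/
noncomputable def powX0 (z : ℂ) : NCSeries ℂ := NCSeries.exp (Complex.log z • X 0)

/-- `z^{-X₀}`. -/
noncomputable def powNegX0 (z : ℂ) : NCSeries ℂ := NCSeries.exp (-Complex.log z • X 0)

/-- `(1-z)^{-X₁}`. -/
noncomputable def powNegX1 (z : ℂ) : NCSeries ℂ := NCSeries.exp (-Complex.log (1 - z) • X 1)

/-- Holomorphic on `U`, coefficient by coefficient. -/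
def HolomorphicOn (F : ℂ → NCSeries ℂ) (U : Set ℂ) : Prop :=
  ∀ w, DifferentiableOn ℂ (fun z => F z w) U

/-- Holomorphic at the point `p`, coefficient by coefficient. -/
def HolomorphicAt (F : ℂ → NCSeries ℂ) (p : ℂ) : Prop :=
  ∀ w, AnalyticAt ℂ (fun z => F z w) p

/-- `dF/dz → 0` as `z → ∞` in `U`, coefficient by coefficient. -/
def DerivTendstoZero (F : ℂ → NCSeries ℂ) (U : Set ℂ) : Prop :=
  ∀ w, Tendsto (fun z => deriv (fun ζ => F ζ w) z) (Bornology.cobounded ℂ ⊓ 𝓟 U) (𝓝 0)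

/-- `F = ∑_w f(reg(w)) W` for some linear form `f`. -/
def HasRegForm (reg : Shuffle →ₗ[ℂ] Shuffle) (F : NCSeries ℂ) : Prop :=
  ∃ f : Shuffle →ₗ[ℂ] ℂ, ∀ w, F w = f (reg (Shuffle.word w))

/-- `(F0, F1)` solves the Riemann-Hilbert problem for the KZ equation. -/
structure IsRHSolution (F0 F1 : ℂ → NCSeries ℂ) : Prop where
  form0 : ∀ z ∈ D0, HasRegForm Shuffle.reg0 (F0 z)
  form1 : ∀ z ∈ D1, HasRegForm Shuffle.reg1 (F1 z)
  holo0 : HolomorphicOn F0 D0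
  holo1 : HolomorphicOn F1 D1
  grouplike0 : ∀ z ∈ D0, IsGrouplike (F0 z)
  grouplike1 : ∀ z ∈ D1, IsGrouplike (F1 z)
  rel : ∀ z ∈ D0 ∩ D1, Ring.inverse (F1 z) * F0 z = powNegX1 z * PhiKZ * powNegX0 z
  asymp0 : DerivTendstoZero F0 D0
  asymp1 : DerivTendstoZero F1 D1
  norm0 : F0 0 = 1

/-- `G` solves `dG/dz = (X₀/z + X₁/(1-z)) G` on `D₀ ∩ D₁`. -/
def IsKZSolution (G : ℂ → NCSeries ℂ) : Prop :=
  ∀ z ∈ D0 ∩ D1, ∀ w, HasDerivAt (fun ζ => G ζ w)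
    ((((1 / z) • X 0 + (1 / (1 - z)) • X 1 : NCSeries ℂ) * G z) w) z

/-- `G` is the fundamental solution normalized at `z = 0`: a solution of the form
`Ĝ(z) z^{X₀}` with `Ĝ` holomorphic at `0` and `Ĝ(0) = 1`. -/
def IsFundamentalSolutionAtZero (G : ℂ → NCSeries ℂ) : Prop :=
  IsKZSolution G ∧ ∃ H : ℂ → NCSeries ℂ, HolomorphicAt H 0 ∧ H 0 = 1 ∧
    ∀ z ∈ D0 ∩ D1, G z = H z * powX0 z

/-- `G` is the fundamental solution normalized at `z = 1`: a solution of the form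
`Ĝ(z) (1-z)^{-X₁}` with `Ĝ` holomorphic at `1` and `Ĝ(1) = 1`. -/
def IsFundamentalSolutionAtOne (G : ℂ → NCSeries ℂ) : Prop :=
  IsKZSolution G ∧ ∃ H : ℂ → NCSeries ℂ, HolomorphicAt H 1 ∧ H 1 = 1 ∧
    ∀ z ∈ D0 ∩ D1, G z = H z * powNegX1 z

end KZ

/-! The coproduct is dual to the shuffle product, so a grouplike series is the same thing as a
character of the shuffle algebra (`isGrouplike_iff`). A character that vanishes on `ξ_a` is
unchanged by `regWith D a` (`IsGrouplike.hasRegForm`), so the two required forms reduce to the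
vanishing of one coefficient each.

Existence. Splitting `z^{X₀}` off a solution of the KZ equation leaves a series `F` with `dF/dz =
(X₀ F - F X₀)/z + X₁ F/(1-z)` and `F(0) = 1`. On the simply connected domain `D0` this is integrated
word by word, the singularity at `0` being removable; the result is `polylogSeries`. It is grouplike
because the two sides of each shuffle relation satisfy the same differential equation
(`pairing_polylogSeries_mul`). The KZ equation is invariant under `z ↦ 1 - z`, `X₀ ↦ -X₁`, `X₁ ↦
-X₀`, which turns `polylogSeries` into the solution `dualPolylogSeries` at `1`. The derivatives
decay because `(1 - z) f'` is bounded by a power of `log(1 - z)` for every coefficient `f`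
(`exists_bound_polylog`).

Two solutions of the KZ equation differ by a constant right factor `C`. Multiplying by `(1-x)^{X₁}`
and letting `x` increase to `1` computes it: one side tends to `C`, while on the other the
coefficient of `w` is the polylogarithm of `reg10 w`, which tends to `ζ(reg10 w)`. Hence `C = PhiKZ`
(`polylogSeries_eq`), which is the multiplicative relation.

Uniqueness. By induction on the word, the relation forces the differences of the coefficients of two
solution pairs to agree on `D0 ∩ D1`. As `D0` and `D1` cover the plane, these differences glue to an
entire function whose derivative tends to `0` at infinity, so it is constant by Liouville, and it
vanishes at `0` (`IsRHSolution.eqOn`). Every solution is therefore the explicit one, from which the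
fundamental solutions are read off. -/

namespace KZ

namespace NCSeries

/-! ### Pairing series with the shuffle algebra -/

/-- The linear form on the shuffle algebra given by the coefficients of a series. -/
noncomputable def pairing (F : NCSeries ℂ) : Shuffle →ₗ[ℂ] ℂ := Shuffle.extend F

@[simp] theorem pairing_word (F : NCSeries ℂ) (w : Word) : pairing F (Shuffle.word w) = F w :=
  Shuffle.extend_word F w

theorem tmul_one_X_mul (a : Fin 2) (T : NCSeries (NCSeries ℂ)) (u : Word) :
    (tmul 1 (X a) * T) u = X a * T u := by
  cases u with
  | nil => simp [mul_nil, tmul, one_apply]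
  | cons b u =>
    have h : tail b (tmul 1 (X a)) = 0 := ext fun v => by
      simp [tail, tmul, one_apply, zero_apply]
    rw [mul_cons, h, zero_mul, zero_apply, add_zero]
    simp [tmul, one_apply]

theorem tail_X {R : Type} [Ring R] (a b : Fin 2) :
    tail b (X a : NCSeries R) = if b = a then 1 else 0 :=
  ext fun v => by by_cases h : b = a <;> simp [tail, X, one_apply, zero_apply, h]

theorem X_mul_nil {R : Type} [Ring R] (a : Fin 2) (F : NCSeries R) :
    (X a * F : NCSeries R) [] = 0 := by
  simp [mul_nil, X]

theorem X_mul_cons {R : Type} [Ring R] (a b : Fin 2) (F : NCSeries R) (w : Word) :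
    (X a * F : NCSeries R) (b :: w) = if b = a then F w else 0 := by
  rw [mul_cons, tail_X]
  by_cases h : b = a <;> simp [X, h, zero_apply]

theorem X_mul_apply {R : Type} [Ring R] (a : Fin 2) (F : NCSeries R) (w : Word) :
    (X a * F : NCSeries R) w = if w.head? = some a then F w.tail else 0 := by
  cases w with
  | nil => simp [X_mul_nil]
  | cons b w => rw [X_mul_cons]; simp

theorem tmul_X_one_mul (a : Fin 2) (T : NCSeries (NCSeries ℂ)) :
    tmul (X a) 1 * T = X a * T := by
  congr 1
  exact ext fun w => by by_cases h : w = [a] <;> simp [tmul, X, h]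

/-- Both sides obey the same recursion in the first letter of `w`: multiplication by `1 ⊗ X_a + X_a
⊗ 1` on the left, and on the right the fact that `stripFirst a` is a derivation for the shuffle
product. -/
theorem comulWord_apply (w u v : Word) :
    comulWord w u v = Shuffle.coeff w (Shuffle.shuffleWord u v) := by
  induction w generalizing u v with
  | nil =>
    rw [comulWord, List.map_nil, List.prod_nil, one_apply]
    cases u with
    | nil => rw [if_pos rfl, one_apply, Shuffle.shuffleWord, Shuffle.coeff_word]
    | cons a u =>
      rw [if_neg (by simp), zero_apply]
      cases v with
      | nil => simp [Shuffle.shuffleWord, Shuffle.coeff_word]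
      | cons b v =>
        have h : ∀ a f, Shuffle.coeff [] (Shuffle.prepend a f) = 0 := fun a f => by
          have e : Shuffle.coeff [] ∘ₗ Shuffle.prepend a = 0 := Shuffle.hom_ext fun w => by
            simp [Shuffle.prepend, Shuffle.coeff_word]
          exact congrArg (fun m => m f) e
        rw [Shuffle.shuffleWord, map_add, h, h, add_zero]
  | cons a w ih =>
    have e : comulWord (a :: w) = (tmul 1 (X a) + tmul (X a) 1) * comulWord w := by
      simp [comulWord]
    have hs : ∀ u : Word, Shuffle.stripFirst a (Shuffle.word u) =
        if u.head? = some a then Shuffle.word u.tail else 0 := fun u => by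
      simp [Shuffle.stripFirst]
    rw [e, add_mul, tmul_X_one_mul, add_apply, add_apply, tmul_one_X_mul,
      ← Shuffle.coeff_stripFirst, ← Shuffle.word_mul_word, Shuffle.stripFirst_mul, map_add, hs, hs,
      add_comm]
    congr 1
    · cases u with
      | nil => simp [X_mul_nil, zero_apply]
      | cons b u =>
        rw [X_mul_cons]
        by_cases h : b = a <;> simp [h, ih, Shuffle.word_mul_word, zero_apply]
    · cases v with
      | nil => simp [X_mul_nil]
      | cons b v =>
        rw [X_mul_cons]
        by_cases h : b = a <;> simp [h, ih, Shuffle.word_mul_word]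

/-- Homogeneity of the shuffle product; it justifies that `comul` sums only over words of length
`|u| + |v|`. -/
theorem shuffleWord_mem_span (u v : Word) : Shuffle.shuffleWord u v ∈
    Submodule.span ℂ (Shuffle.word '' {w | w.length = u.length + v.length}) := by
  have hp : ∀ (a : Fin 2) (n : ℕ) (f : Shuffle),
      f ∈ Submodule.span ℂ (Shuffle.word '' {w | w.length = n}) →
      Shuffle.prepend a f ∈ Submodule.span ℂ (Shuffle.word '' {w | w.length = n + 1}) := by
    intro a n f hf
    refine Submodule.span_induction (p := fun f _ => Shuffle.prepend a f ∈
      Submodule.span ℂ (Shuffle.word '' {w | w.length = n + 1})) ?_ (by simp)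
      (fun f g _ _ hf hg => by rw [map_add]; exact Submodule.add_mem _ hf hg)
      (fun c f _ hf => by rw [map_smul]; exact Submodule.smul_mem _ c hf) hf
    rintro _ ⟨w, hw, rfl⟩
    rw [Shuffle.prepend_word]
    exact Submodule.subset_span ⟨_, by simpa using hw, rfl⟩
  induction u generalizing v with
  | nil => exact Submodule.subset_span ⟨v, by simp, by rw [Shuffle.shuffleWord]⟩
  | cons a u ihu =>
    induction v with
    | nil => exact Submodule.subset_span ⟨a :: u, by simp, by rw [Shuffle.shuffleWord]⟩
    | cons b v ihv =>
      rw [Shuffle.shuffleWord]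
      refine Submodule.add_mem _ ?_ ?_
      · have := hp a _ _ (ihu (b :: v))
        rwa [show (a :: u).length + (b :: v).length = u.length + (b :: v).length + 1 by
          simp only [List.length_cons]; omega]
      · exact hp b _ _ ihv

theorem comul_apply (F : NCSeries ℂ) (u v : Word) :
    comul F u v = pairing F (Shuffle.shuffleWord u v) := by
  have key : ∀ f ∈ Submodule.span ℂ (Shuffle.word '' {w | w.length = u.length + v.length}),
      ∑ w : Fin (u.length + v.length) → Fin 2, F (List.ofFn w) * Shuffle.coeff (List.ofFn w) f =
        pairing F f := by
    intro f hf
    refine Submodule.span_induction (p := fun f _ =>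
      ∑ w : Fin (u.length + v.length) → Fin 2, F (List.ofFn w) * Shuffle.coeff (List.ofFn w) f =
        pairing F f) ?_ (by simp) (fun f g _ _ hf hg => ?_) (fun c f _ hf => ?_) hf
    · rintro _ ⟨w, hw, rfl⟩
      rw [Set.mem_ofPred_eq] at hw
      generalize u.length + v.length = n at hw ⊢
      subst hw
      rw [Finset.sum_eq_single w.get]
      · rw [List.ofFn_get, Shuffle.coeff_word, if_pos rfl, mul_one, pairing_word]
      · intro x _ hx
        rw [Shuffle.coeff_word, if_neg, mul_zero]
        rintro h
        apply hx
        apply List.ofFn_injective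
        rw [← h, List.ofFn_get]
      · simp
    · simp only [map_add, mul_add, Finset.sum_add_distrib, hf, hg]
    · simp only [map_smul, smul_eq_mul, ← hf, Finset.mul_sum]
      exact Finset.sum_congr rfl fun _ _ => by ring
  rw [← key _ (shuffleWord_mem_span u v)]
  exact Finset.sum_congr rfl fun w _ => by rw [comulWord_apply]

/-- Through `comul_apply` the coproduct condition becomes multiplicativity on shuffles of words, so
grouplike series are characters. -/
theorem isGrouplike_iff (F : NCSeries ℂ) : IsGrouplike F ↔
    F [] = 1 ∧ ∀ u v, pairing F (Shuffle.shuffleWord u v) = F u * F v := by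
  refine and_congr_right fun _ => ⟨fun h u v => ?_, fun h => ext fun u => ext fun v => ?_⟩
  · rw [← comul_apply, h]; rfl
  · rw [comul_apply, h]; rfl

theorem IsGrouplike.pairing_mul {F : NCSeries ℂ} (hF : IsGrouplike F) (f g : Shuffle) :
    pairing F (f * g) = pairing F f * pairing F g := by
  have e : Shuffle.mulL.compr₂ (pairing F) =
      (LinearMap.mul ℂ ℂ).compl₁₂ (pairing F) (pairing F) :=
    Shuffle.hom_ext fun u => Shuffle.hom_ext fun v => by
      simpa [Shuffle.mulL] using ((isGrouplike_iff F).mp hF).2 u v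
  exact congrArg (fun m => m f g) e

/-- The shuffle of `ξ_a` with `ξ_aⁿ` is `(n + 1) ξ_a^{n+1}`, and `F` is multiplicative on it. -/
theorem IsGrouplike.apply_replicate {F : NCSeries ℂ} (hF : IsGrouplike F) (a : Fin 2) (n : ℕ) :
    F (List.replicate n a) = F [a] ^ n / (n.factorial : ℂ) := by
  induction n with
  | zero => simpa using hF.1
  | succ n ih =>
    have h := hF.pairing_mul (Shuffle.word (List.replicate 1 a)) (Shuffle.word (List.replicate n a))
    rw [Shuffle.replicate_mul, map_smul, pairing_word, pairing_word, pairing_word, ih,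
      Nat.choose_one_right, smul_eq_mul, Nat.add_comm 1 n] at h
    rw [Nat.factorial_succ]
    have h1 : ((n + 1 : ℕ) : ℂ) ≠ 0 := by exact_mod_cast n.succ_ne_zero
    have h2 : (n.factorial : ℂ) ≠ 0 := by exact_mod_cast n.factorial_ne_zero
    push_cast at h h1 ⊢
    rw [eq_div_iff (mul_ne_zero h1 h2)]
    field_simp at h
    linear_combination h

/-- Every term of `regWith` with `j > 0` is a shuffle multiple of `ξ_a^j`, on which `F` takes the
value `F [a] ^ j / j! = 0`; the term `j = 0` is the argument itself. Nothing about `D` beyond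
linearity enters. -/
theorem IsGrouplike.pairing_regWith {F : NCSeries ℂ} (hF : IsGrouplike F) {a : Fin 2}
    (ha : F [a] = 0) (D : Shuffle →ₗ[ℂ] Shuffle) (f : Shuffle) :
    pairing F (Shuffle.regWith D a f) = pairing F f := by
  have e : pairing F ∘ₗ Shuffle.regWith D a = pairing F := Shuffle.hom_ext fun w => by
    rw [LinearMap.comp_apply, Shuffle.regWith, Shuffle.extend_word, map_sum,
      Finset.sum_eq_single 0]
    · rw [List.replicate_zero, ← Shuffle.one_def, mul_one]
      simp
    · intro j _ hj
      rw [map_smul, hF.pairing_mul, pairing_word F (List.replicate j a), hF.apply_replicate, ha,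
        zero_pow hj, zero_div, mul_zero, smul_zero]
    · simp
  exact congrArg (fun m => m f) e

theorem IsGrouplike.hasRegForm {F : NCSeries ℂ} (hF : IsGrouplike F) {a : Fin 2}
    (ha : F [a] = 0) (D : Shuffle →ₗ[ℂ] Shuffle) : HasRegForm (Shuffle.regWith D a) F :=
  ⟨pairing F, fun w => by rw [hF.pairing_regWith ha, pairing_word]⟩

/-! ### Invertible series -/

/-- Coefficients of the left inverse of a series with constant term `1`. -/
noncomputable def leftInv (F : NCSeries ℂ) : NCSeries ℂ := fun w =>
  if w = [] then 1
  else -∑ i : Fin w.length, leftInv F (w.take i) * F (w.drop i)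
termination_by w => w.length
decreasing_by simp

theorem leftInv_mul {F : NCSeries ℂ} (hF : F [] = 1) : leftInv F * F = 1 := by
  refine ext fun w => ?_
  rw [mul_apply, Finset.sum_range_succ, List.take_length, List.drop_length, hF, mul_one,
    one_apply]
  by_cases h : w = []
  · subst h
    rw [leftInv]
    simp
  · rw [if_neg h, leftInv, if_neg h, Finset.sum_range fun i => leftInv F (w.take i) * F (w.drop i),
      add_neg_cancel]

/-- The left inverse again has constant term `1`, so it has a left inverse of its own, which must
coincide with `F`. -/
theorem isUnit_of_nil {F : NCSeries ℂ} (hF : F [] = 1) : IsUnit F := by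
  have h1 := leftInv_mul hF
  have h0 : leftInv F [] = 1 := by rw [leftInv, if_pos rfl]
  have h2 := leftInv_mul (F := leftInv F) h0
  have h3 : leftInv (leftInv F) = F := left_inv_eq_right_inv h2 h1
  rw [h3] at h2
  exact ⟨⟨F, leftInv F, h2, h1⟩, rfl⟩

/-! ### Products with variables and exponentials -/

theorem mul_X_nil (F : NCSeries ℂ) (a : Fin 2) : (F * X a : NCSeries ℂ) [] = 0 := by
  simp [mul_nil, X]

theorem mul_X_concat (F : NCSeries ℂ) (a b : Fin 2) (w : Word) :
    (F * X a : NCSeries ℂ) (w ++ [b]) = if b = a then F w else 0 := by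
  rw [mul_apply, Finset.sum_eq_single w.length]
  · simp [X]
  · intro i _ hi
    rw [X, if_neg, mul_zero]
    intro h
    have := congrArg List.length h
    simp at this
    omega
  · simp

theorem mul_X_apply (F : NCSeries ℂ) (a : Fin 2) (w : Word) :
    (F * X a : NCSeries ℂ) w = if w.getLast? = some a then F w.dropLast else 0 := by
  induction w using List.reverseRecOn with
  | nil => simp [mul_X_nil]
  | append_singleton w b _ => rw [mul_X_concat]; simp

theorem smul_mul (c : ℂ) (F G : NCSeries ℂ) : (c • F) * G = c • (F * G) := scale_mul c F G

theorem smul_apply (c : ℂ) (F : NCSeries ℂ) (w : Word) : (c • F) w = c * F w := rfl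

theorem neg_apply (F : NCSeries ℂ) (w : Word) : (-F) w = -F w := rfl

theorem sub_apply (F G : NCSeries ℂ) (w : Word) : (F - G) w = F w - G w := rfl

theorem mul_smul_comm' (c : ℂ) (F G : NCSeries ℂ) : F * (c • G) = c • (F * G) :=
  ext fun w => by
    simp only [mul_apply, smul_apply, Finset.mul_sum]
    exact Finset.sum_congr rfl fun i _ => by ring

theorem smul_X_pow (c : ℂ) (a : Fin 2) (n : ℕ) (w : Word) :
    ((c • X a : NCSeries ℂ) ^ n) w = if w = List.replicate n a then c ^ n else 0 := by
  induction n generalizing w with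
  | zero => simp [one_apply]
  | succ n ih =>
    rw [pow_succ', smul_mul, smul_apply]
    cases w with
    | nil => simp [X_mul_nil, List.replicate_succ]
    | cons b w =>
      rw [X_mul_cons, ih, List.replicate_succ]
      by_cases h : b = a <;> by_cases h' : w = List.replicate n a <;>
        simp [h, h', pow_succ']

theorem exp_smul_X (c : ℂ) (a : Fin 2) (w : Word) : exp (c • X a) w =
    if w = List.replicate w.length a then c ^ w.length / (w.length.factorial : ℂ) else 0 := by
  rw [exp, Finset.sum_eq_single w.length]
  · rw [smul_X_pow]
    split_ifs <;> simp
  · intro n _ hn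
    rw [smul_X_pow, if_neg, zero_div]
    intro h
    exact hn (by simpa using (congrArg List.length h).symm)
  · simp

theorem exp_smul_X_nil (c : ℂ) (a : Fin 2) : exp (c • X a) [] = 1 := by
  simp [exp_smul_X]

/-- On powers of the letter `a` this is the binomial expansion of `(c - c)ⁿ / n!`. In any other word
a foreign letter lies in the prefix or in the suffix of each cut. -/
theorem exp_smul_X_mul_neg (c : ℂ) (a : Fin 2) : exp (c • X a) * exp (-c • X a) = 1 := by
  refine ext fun w => ?_
  rw [mul_apply, one_apply]
  simp only [exp_smul_X]
  by_cases hw : w = List.replicate w.length a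
  · generalize w.length = n at hw
    subst hw
    have h : ∀ i ∈ Finset.range (n + 1), (if (List.replicate n a).take i =
          List.replicate ((List.replicate n a).take i).length a then
          c ^ ((List.replicate n a).take i).length /
            (((List.replicate n a).take i).length.factorial : ℂ) else 0) *
        (if (List.replicate n a).drop i =
          List.replicate ((List.replicate n a).drop i).length a then
          (-c) ^ ((List.replicate n a).drop i).length /
            (((List.replicate n a).drop i).length.factorial : ℂ) else 0) =
        (n.factorial : ℂ)⁻¹ * (c ^ i * (-c) ^ (n - i) * (n.choose i : ℂ)) := fun i hi => by
      have hi' : i ≤ n := Nat.lt_succ_iff.mp (Finset.mem_range.mp hi)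
      rw [List.take_replicate, List.drop_replicate, List.length_replicate, List.length_replicate,
        if_pos rfl, if_pos rfl, min_eq_left hi', Nat.cast_choose ℂ hi']
      have : (n.factorial : ℂ) ≠ 0 := by exact_mod_cast n.factorial_ne_zero
      field_simp
    rw [Finset.sum_congr rfl h, ← Finset.mul_sum, ← add_pow,
      add_neg_cancel]
    cases n <;> simp [List.replicate_succ]
  · rw [if_neg (by rintro rfl; exact hw rfl)]
    refine Finset.sum_eq_zero fun i _ => ?_
    by_cases h1 : w.take i = List.replicate (w.take i).length a
    · rw [if_neg (c := w.drop i = _), mul_zero]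
      intro h2
      apply hw
      rw [List.eq_replicate_iff] at h1 h2 ⊢
      refine ⟨rfl, fun b hb => ?_⟩
      rw [← List.take_append_drop i w, List.mem_append] at hb
      exact hb.elim (h1.2 b) (h2.2 b)
    · rw [if_neg h1, zero_mul]

/-- Only prefixes that are powers of `a` contribute, and removing such a prefix is a power of
`stripFirst a`. This is the shape of `regWith (stripFirst a) a`, with which it is compared below. -/
theorem exp_smul_X_mul (F : NCSeries ℂ) (c : ℂ) (a : Fin 2) (w : Word) :
    (exp (c • X a) * F) w = ∑ i ∈ Finset.range (w.length + 1),
      (c ^ i / (i.factorial : ℂ)) * pairing F ((Shuffle.stripFirst a ^ i) (Shuffle.word w)) := by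
  rw [mul_apply]
  refine Finset.sum_congr rfl fun i hi => ?_
  have hi' : i ≤ w.length := Nat.lt_succ_iff.mp (Finset.mem_range.mp hi)
  have hs : ∀ (i : ℕ) (w : Word), i ≤ w.length → (Shuffle.stripFirst a ^ i) (Shuffle.word w) =
      if w.take i = List.replicate i a then Shuffle.word (w.drop i) else 0 := by
    intro i
    induction i with
    | zero => simp
    | succ i ih =>
      rintro (_ | ⟨b, w⟩) hw
      · simp at hw
      · rw [pow_succ, Module.End.mul_apply, ← Shuffle.prepend_word, Shuffle.stripFirst_prepend]
        by_cases h : b = a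
        · simp only [h, if_true, ih w (by simpa using hw), List.take_succ_cons,
            List.replicate_succ, List.cons.injEq, true_and, List.drop_succ_cons]
        · simp [h, List.replicate_succ]
  rw [exp_smul_X, hs i w hi', List.length_take, min_eq_left hi']
  split_ifs <;> simp

/-! ### The exchange of the variables -/

/-- Exchange of the letters `0` and `1`. -/
def flipWord (w : Word) : Word := w.map Fin.rev

/-- The substitution `X₀ ↦ -X₁`, `X₁ ↦ -X₀`. -/
noncomputable def negFlip (F : NCSeries ℂ) : NCSeries ℂ :=
  fun w => (-1) ^ w.length * F (flipWord w)

/-- The transpose `N` of the substitution sends `w` to `(-1)^{|w|}` times the flipped word. It is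
multiplicative for the shuffle product, so composing the character `F` with it gives a character. -/
theorem IsGrouplike.negFlip {F : NCSeries ℂ} (hF : IsGrouplike F) :
    IsGrouplike (negFlip F) := by
  rw [isGrouplike_iff]
  refine ⟨by simpa [NCSeries.negFlip, flipWord] using hF.1, fun u v => ?_⟩
  set N : Shuffle →ₗ[ℂ] Shuffle :=
    Shuffle.extend fun w => (-1 : ℂ) ^ w.length • Shuffle.word (flipWord w) with hN
  have hNw : ∀ w, N (Shuffle.word w) = (-1 : ℂ) ^ w.length • Shuffle.word (flipWord w) :=
    fun w => by rw [hN, Shuffle.extend_word]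
  have hNp : ∀ a f, N (Shuffle.prepend a f) = -Shuffle.prepend a.rev (N f) := fun a f => by
    have e : N ∘ₗ Shuffle.prepend a = -(Shuffle.prepend a.rev ∘ₗ N) := Shuffle.hom_ext fun w => by
      simp [hNw, Shuffle.prepend_word, flipWord, pow_succ]
    exact congrArg (fun m => m f) e
  have hNm : ∀ u v, N (Shuffle.word u * Shuffle.word v) =
      N (Shuffle.word u) * N (Shuffle.word v) := by
    intro u
    induction u with
    | nil =>
      intro v
      have h1 : N (Shuffle.word []) = 1 := by simp [hNw, flipWord, Shuffle.one_def]
      rw [h1, ← Shuffle.one_def, one_mul, one_mul]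
    | cons a u ihu =>
      intro v
      induction v with
      | nil =>
        have h1 : N (Shuffle.word []) = 1 := by simp [hNw, flipWord, Shuffle.one_def]
        rw [h1, ← Shuffle.one_def, mul_one, mul_one]
      | cons b v ihv =>
        have ihu1 := ihu (b :: v)
        simp only [← Shuffle.prepend_word] at ihu1 ihv ⊢
        rw [Shuffle.prepend_mul_prepend, map_add, hNp, hNp, ihu1, ihv, hNp, hNp, neg_mul_neg,
          Shuffle.prepend_mul_prepend]
        simp only [mul_neg, neg_mul, map_neg, neg_neg]
  have hp : pairing (NCSeries.negFlip F) = pairing F ∘ₗ N := Shuffle.hom_ext fun w => by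
    simp [hNw, NCSeries.negFlip]
  rw [← Shuffle.word_mul_word, hp, LinearMap.comp_apply, hNm, hF.pairing_mul]
  simp [hNw, NCSeries.negFlip]

end NCSeries

/-- The constant term of a polynomial in a slice is an algebra morphism. -/
theorem Shuffle.IsSlice.regWith_mul {D : Shuffle →ₗ[ℂ] Shuffle} {a : Fin 2}
    (hD : Shuffle.IsSlice D a) (f g : Shuffle) :
    Shuffle.regWith D a (f * g) = Shuffle.regWith D a f * Shuffle.regWith D a g := by
  obtain ⟨m, c, hc, hf, hf0⟩ := (hD.regWith_eq_iff f _).mp rfl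
  obtain ⟨n, d, hd, hg, hg0⟩ := (hD.regWith_eq_iff g _).mp rfl
  -- Products of coefficients remain in `ker D`, and `ξ_a^i ⧢ ξ_a^j` is a multiple of `ξ_a^{i+j}`;
  -- only `i = j = 0` reaches the constant term.
  rw [hf0, hg0, hf, hg, Finset.sum_mul_sum, map_sum, Finset.sum_eq_single 0]
  · rw [map_sum, Finset.sum_eq_single 0]
    · have hcd : D (c 0 * d 0) = 0 := by rw [hD.leibniz, hc, hd, zero_mul, mul_zero, add_zero]
      have := hD.regWith_mul_replicate hcd 0
      rw [if_pos rfl, List.replicate_zero, ← Shuffle.one_def, mul_one] at this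
      rw [List.replicate_zero, ← Shuffle.one_def, mul_one, mul_one, this]
    · intro j _ hj
      have hcd : D (c 0 * d j) = 0 := by rw [hD.leibniz, hc, hd, zero_mul, mul_zero, add_zero]
      have := hD.regWith_mul_replicate hcd j
      rw [if_neg hj] at this
      rw [← this, List.replicate_zero, ← Shuffle.one_def, mul_one, mul_assoc]
    · simp
  · intro i _ hi
    rw [map_sum]
    refine Finset.sum_eq_zero fun j _ => ?_
    have hcd : D (c i * d j) = 0 := by rw [hD.leibniz, hc, hd, zero_mul, mul_zero, add_zero]
    have := hD.regWith_mul_replicate hcd (i + j)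
    rw [if_neg (by omega)] at this
    rw [mul_mul_mul_comm, Shuffle.replicate_mul, Shuffle.mul_smul', map_smul, this, smul_zero]
  · simp

/-! ### The domains -/

theorem mem_D1_iff (z : ℂ) : z ∈ D1 ↔ z ∈ Complex.slitPlane := by
  rw [Complex.mem_slitPlane_iff_not_le_zero, D1, Set.mem_ofPred_eq, not_iff_not]
  constructor
  · rintro ⟨x, hx, rfl⟩
    exact_mod_cast hx
  · intro h
    rw [Complex.le_def] at h
    exact ⟨z.re, h.1, Complex.ext rfl (by simpa using h.2)⟩

theorem mem_D0_iff (z : ℂ) : z ∈ D0 ↔ 1 - z ∈ Complex.slitPlane := by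
  rw [← mem_D1_iff, D0, D1, Set.mem_ofPred_eq, Set.mem_ofPred_eq, not_iff_not]
  constructor
  · rintro ⟨x, hx, rfl⟩
    exact ⟨1 - x, by linarith, by push_cast; ring⟩
  · rintro ⟨x, hx, h⟩
    exact ⟨1 - x, by linarith, by push_cast; linear_combination -h⟩

theorem one_sub_mem_D0_iff (z : ℂ) : 1 - z ∈ D0 ↔ z ∈ D1 := by
  rw [mem_D0_iff, mem_D1_iff, sub_sub_cancel]

theorem D0_eq : D0 = (fun z => 1 - z) ⁻¹' Complex.slitPlane := Set.ext mem_D0_iff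

theorem D1_eq : D1 = Complex.slitPlane := Set.ext mem_D1_iff

theorem isOpen_D0 : IsOpen D0 := by
  rw [D0_eq]
  exact Complex.isOpen_slitPlane.preimage (by fun_prop)

theorem isOpen_D1 : IsOpen D1 := by
  rw [D1_eq]
  exact Complex.isOpen_slitPlane

theorem zero_mem_D0 : (0 : ℂ) ∈ D0 := by simp [mem_D0_iff]

theorem D0_mem_nhds : D0 ∈ 𝓝 (0 : ℂ) := isOpen_D0.mem_nhds zero_mem_D0

theorem mem_D0_or_mem_D1 (z : ℂ) : z ∈ D0 ∨ z ∈ D1 := by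
  by_contra! h
  simp only [D0, D1, Set.mem_ofPred_eq, not_not] at h
  obtain ⟨⟨x, hx, rfl⟩, y, hy, h⟩ := h
  have : x = y := by exact_mod_cast h
  linarith

theorem ne_zero_of_mem_D1 {z : ℂ} (hz : z ∈ D1) : z ≠ 0 :=
  Complex.slitPlane_ne_zero ((mem_D1_iff z).mp hz)

theorem one_sub_ne_zero_of_mem_D0 {z : ℂ} (hz : z ∈ D0) : 1 - z ≠ 0 :=
  Complex.slitPlane_ne_zero ((mem_D0_iff z).mp hz)

theorem mem_D0_of_norm_lt_one {z : ℂ} (hz : ‖z‖ < 1) : z ∈ D0 := by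
  rintro ⟨x, hx, rfl⟩
  rw [Complex.norm_real, Real.norm_eq_abs] at hz
  linarith [le_abs_self x]

theorem mem_D1_of_re_pos {z : ℂ} (hz : 0 < z.re) : z ∈ D1 :=
  (mem_D1_iff z).mpr (Or.inl hz)

theorem starConvex_D0 {x : ℝ} (hx : x < 1) : StarConvex ℝ (x : ℂ) D0 := by
  intro z hz a b ha hb hab
  rw [mem_D0_iff] at hz ⊢
  have h := Complex.starConvex_ofReal_slitPlane (x := 1 - x) (by linarith) hz ha hb hab
  have hab' : (a : ℂ) + b = 1 := by exact_mod_cast hab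
  convert h using 1
  simp only [Complex.real_smul]
  push_cast
  linear_combination -hab'

theorem starConvex_D1 {x : ℝ} (hx : 0 < x) : StarConvex ℝ (x : ℂ) D1 := by
  rw [D1_eq]
  exact Complex.starConvex_ofReal_slitPlane hx

theorem isPreconnected_D0 : IsPreconnected D0 :=
  ((starConvex_D0 (x := 0) one_pos).isPathConnected
    (by simpa using zero_mem_D0)).isConnected.isPreconnected

theorem half_mem : ((1 / 2 : ℝ) : ℂ) ∈ D0 ∩ D1 := by
  rw [Set.mem_inter_iff, mem_D0_iff, mem_D1_iff]
  constructor <;> left <;> norm_num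

theorem isPreconnected_D0_inter_D1 : IsPreconnected (D0 ∩ D1) :=
  (((starConvex_D0 (x := 1 / 2) (by norm_num)).inter
    (starConvex_D1 (by norm_num))).isPathConnected
    half_mem).isConnected.isPreconnected

/-! ### Primitives on `D0` -/

theorem sq_mem_slitPlane {q : ℂ} (hq : 0 < q.re) : q ^ 2 ∈ Complex.slitPlane := by
  rw [Complex.mem_slitPlane_iff]
  by_cases h : q.im = 0
  · left
    simp [pow_two, h, hq]
  · right
    simp only [pow_two, Complex.mul_im]
    intro h'
    have : q.re * q.im = 0 := by linarith
    rcases mul_eq_zero.mp this with h1 | h1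
    · exact hq.ne' h1
    · exact h h1

/-- The unit disc is mapped biholomorphically onto `D0` by `u(t) = 1 - ((1-t)/(1+t))²`: the Cayley
transform to the right half-plane, squaring to the slit plane, then `z ↦ 1 - z`. The inverse is `τ`,
built from the square root `s` of `1 - z`. The pulled-back form `g(u(t)) u'(t) dt` has a primitive
on the disc, and composing it with `τ` gives one of `g`. -/
theorem exists_primitive {g : ℂ → ℂ} (hg : DifferentiableOn ℂ g D0) :
    ∃ G : ℂ → ℂ, G 0 = 0 ∧ ∀ z ∈ D0, HasDerivAt G (g z) z := by
  set u : ℂ → ℂ := fun t => 1 - ((1 - t) / (1 + t)) ^ 2 with hu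
  set s : ℂ → ℂ := fun z => Complex.exp (Complex.log (1 - z) / 2) with hs
  set τ : ℂ → ℂ := fun z => (1 - s z) / (1 + s z) with hτ
  have h1 : ∀ t ∈ Metric.ball (0 : ℂ) 1, 1 + t ≠ 0 := fun t ht h => by
    rw [mem_ball_zero_iff, ← neg_eq_of_add_eq_zero_right h] at ht
    simp at ht
  -- The argument of `1 - z` is strictly between `-π` and `π`, so halving it gives positive cosine.
  have hsre : ∀ z ∈ D0, 0 < (s z).re := fun z hz => by
    rw [hs, Complex.exp_re]
    refine mul_pos (Real.exp_pos _) (Real.cos_pos_of_mem_Ioo ?_)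
    have h := Complex.mem_slitPlane_iff_arg.mp ((mem_D0_iff z).mp hz)
    have e : (Complex.log (1 - z) / 2).im = Complex.arg (1 - z) / 2 := by
      rw [Complex.div_ofNat_im, Complex.log_im]
    have := Complex.neg_pi_lt_arg (1 - z)
    have := lt_of_le_of_ne (Complex.arg_le_pi (1 - z)) h.1
    rw [e]
    constructor <;> linarith
  have hs1 : ∀ z ∈ D0, 1 + s z ≠ 0 := fun z hz h => by
    have := congrArg Complex.re h
    rw [Complex.add_re, Complex.one_re, Complex.zero_re] at this
    linarith [hsre z hz]
  have hsd : DifferentiableOn ℂ s D0 := fun z hz =>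
    ((((differentiableAt_const _).sub differentiableAt_id).clog
      ((mem_D0_iff z).mp hz)).div_const 2).cexp.differentiableWithinAt
  have hτd : DifferentiableOn ℂ τ D0 := fun z hz =>
    ((differentiableWithinAt_const _).sub (hsd z hz)).div
      ((differentiableWithinAt_const _).add (hsd z hz)) (hs1 z hz)
  have hτb : ∀ z ∈ D0, τ z ∈ Metric.ball (0 : ℂ) 1 := fun z hz => by
    rw [mem_ball_zero_iff, hτ, norm_div, div_lt_one (norm_pos_iff.mpr (hs1 z hz)),
      ← sq_lt_sq₀ (norm_nonneg _) (norm_nonneg _), Complex.sq_norm, Complex.sq_norm,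
      Complex.normSq_apply, Complex.normSq_apply]
    simp only [Complex.sub_re, Complex.sub_im, Complex.add_re, Complex.add_im, Complex.one_re,
      Complex.one_im]
    nlinarith [hsre z hz]
  have huτ : ∀ z ∈ D0, u (τ z) = z := fun z hz => by
    have e : s z ^ 2 = 1 - z := by
      rw [hs, ← Complex.exp_nat_mul]
      push_cast
      rw [mul_div_cancel₀ _ two_ne_zero, Complex.exp_log (one_sub_ne_zero_of_mem_D0 hz)]
    have e2 : (1 - τ z) / (1 + τ z) = s z := by
      have := hs1 z hz
      have h3 : 1 + τ z = 2 / (1 + s z) := by rw [hτ]; field_simp; ring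
      have h4 : 1 - τ z = 2 * s z / (1 + s z) := by rw [hτ]; field_simp; ring
      rw [h3, h4]
      field_simp
    simp only [hu]
    rw [e2, e, sub_sub_cancel]
  have hub : ∀ t ∈ Metric.ball (0 : ℂ) 1, u t ∈ D0 := fun t ht => by
    rw [mem_D0_iff, hu, sub_sub_cancel]
    refine sq_mem_slitPlane ?_
    have hn : 0 < Complex.normSq (1 + t) := Complex.normSq_pos.mpr (h1 t ht)
    rw [Complex.div_re, ← add_div]
    refine div_pos ?_ hn
    rw [mem_ball_zero_iff, ← sq_lt_one_iff₀ (norm_nonneg _), Complex.sq_norm,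
      Complex.normSq_apply] at ht
    simp only [Complex.sub_re, Complex.sub_im, Complex.add_re, Complex.add_im, Complex.one_re,
      Complex.one_im]
    nlinarith
  have hud : DifferentiableOn ℂ u (Metric.ball 0 1) := fun t ht =>
    ((differentiableAt_const _).sub ((((differentiableAt_const _).sub differentiableAt_id).div
      ((differentiableAt_const _).add differentiableAt_id) (h1 t ht)).pow 2)).differentiableWithinAt
  obtain ⟨H, hH⟩ : Complex.IsExactOn (fun t => g (u t) * deriv u t) (Metric.ball 0 1) :=
    ((hg.comp hud hub).mul (hud.deriv Metric.isOpen_ball)).isExactOn_ball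
  refine ⟨fun z => H (τ z) - H (τ 0), sub_self _, fun z hz => ?_⟩
  have hτz := (hτd.differentiableAt (isOpen_D0.mem_nhds hz)).hasDerivAt
  have huz := (hud.differentiableAt (Metric.isOpen_ball.mem_nhds (hτb z hz))).hasDerivAt
  -- Differentiate `u ∘ τ = id`.
  have hc : deriv u (τ z) * deriv τ z = 1 := by
    refine (huz.comp z hτz).unique ((hasDerivAt_id z).congr_of_eventuallyEq ?_)
    filter_upwards [isOpen_D0.mem_nhds hz] with y hy
    exact huτ y hy
  have := ((hH _ (hτb z hz)).comp z hτz).sub_const (H (τ 0))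
  beta_reduce at this
  rwa [huτ z hz, mul_assoc, hc, mul_one] at this

/-- A function with derivative `g` on `D0` which vanishes at `0`. -/
noncomputable def primitive (g : ℂ → ℂ) : ℂ → ℂ :=
  open Classical in
  -- The default value makes the operation total, so that polylogarithms can be defined by recursion
  -- before they are known to be holomorphic.
  if h : DifferentiableOn ℂ g D0 then (exists_primitive h).choose else 0

theorem primitive_zero (g : ℂ → ℂ) : primitive g 0 = 0 := by
  rw [primitive]
  split_ifs with h
  · exact (exists_primitive h).choose_spec.1
  · rfl

theorem hasDerivAt_primitive {g : ℂ → ℂ} (hg : DifferentiableOn ℂ g D0) {z : ℂ} (hz : z ∈ D0) :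
    HasDerivAt (primitive g) (g z) z := by
  rw [primitive, dif_pos hg]
  exact (exists_primitive hg).choose_spec.2 z hz

/-- The differential equations below have a pole at `0` and give derivatives only away from it;
continuity of `deriv E` fills in the missing point. -/
theorem eq_zero_of_deriv_eq_zero {E : ℂ → ℂ} {U : Set ℂ} (hU : IsOpen U) (hc : IsPreconnected U)
    (h0U : (0 : ℂ) ∈ U) (hE : DifferentiableOn ℂ E U) (h0 : E 0 = 0)
    (h : ∀ z ∈ U, z ≠ 0 → deriv E z = 0) {z : ℂ} (hz : z ∈ U) : E z = 0 := by
  have hd : deriv E 0 = 0 := by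
    have hc : ContinuousAt (deriv E) 0 :=
      ((hE.deriv hU).differentiableAt (hU.mem_nhds h0U)).continuousAt
    refine tendsto_nhds_unique (hc.tendsto.mono_left nhdsWithin_le_nhds)
      (tendsto_const_nhds.congr' (f₁ := fun _ => (0 : ℂ)) (l₁ := 𝓝[≠] 0) ?_)
    filter_upwards [self_mem_nhdsWithin, mem_nhdsWithin_of_mem_nhds (hU.mem_nhds h0U)] with y hy hy'
    exact (h y hy' hy).symm
  rw [← h0]
  refine hU.is_const_of_deriv_eq_zero hc hE (fun y hy => ?_) hz h0U
  by_cases hy0 : y = 0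
  · rw [hy0, hd, Pi.zero_apply]
  · exact h y hy hy0

/-! ### The regularized multiple polylogarithms -/

/-- The regularized multiple polylogarithms: the coefficients of the series `F` with `F(0) = 1` and
`dF/dz = (X₀ F - F X₀) / z + X₁ F / (1 - z)`. -/
noncomputable def polylog (w : Word) : ℂ → ℂ :=
  if h : w = [] then fun _ => 1
  else primitive fun z =>
    -- The numerator vanishes at `0` (`polylogComm_zero`), so `dslope` is its quotient by `z` with
    -- the singularity removed.
    dslope (fun ζ => (if w.head? = some 0 then polylog w.tail ζ else 0) -
      if w.getLast? = some 0 then polylog w.dropLast ζ else 0) 0 z +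
    (if w.head? = some 1 then polylog w.tail z else 0) / (1 - z)
termination_by w.length
decreasing_by
  all_goals
    have := List.length_pos_of_ne_nil h
    simp
    omega

/-- The coefficient of `w` in `X₀ F - F X₀`. -/
noncomputable def polylogComm (w : Word) (z : ℂ) : ℂ :=
  (if w.head? = some 0 then polylog w.tail z else 0) -
    if w.getLast? = some 0 then polylog w.dropLast z else 0

/-- The derivative of the regularized multiple polylogarithm of a nonempty word. -/
noncomputable def polylogDeriv (w : Word) (z : ℂ) : ℂ :=
  dslope (polylogComm w) 0 z + (if w.head? = some 1 then polylog w.tail z else 0) / (1 - z)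

theorem polylog_nil (z : ℂ) : polylog [] z = 1 := by rw [polylog, dif_pos rfl]

theorem polylog_of_ne_nil {w : Word} (hw : w ≠ []) : polylog w = primitive (polylogDeriv w) := by
  rw [polylog, dif_neg hw]
  rfl

theorem polylog_zero {w : Word} (hw : w ≠ []) : polylog w 0 = 0 := by
  rw [polylog_of_ne_nil hw, primitive_zero]

theorem differentiableOn_polylog (w : Word) : DifferentiableOn ℂ (polylog w) D0 ∧
    DifferentiableOn ℂ (polylogComm w) D0 ∧ DifferentiableOn ℂ (polylogDeriv w) D0 := by
  induction hn : w.length using Nat.strong_induction_on generalizing w with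
  | _ n ih =>
    subst hn
    by_cases hw : w = []
    · subst hw
      have e : polylog [] = fun _ => 1 := funext polylog_nil
      have e1 : polylogComm [] = fun _ => 0 := funext fun z => by simp [polylogComm]
      have e2 : polylogDeriv [] = fun _ => 0 := funext fun z => by
        rw [polylogDeriv, e1]
        by_cases h : z = 0
        · simp [h, dslope]
        · simp [h, dslope_of_ne, slope]
      rw [e, e1, e2]
      exact ⟨differentiableOn_const _, differentiableOn_const _, differentiableOn_const _⟩
    · have hl := List.length_pos_of_ne_nil hw
      have ht := (ih w.tail.length (by rw [List.length_tail]; omega) w.tail rfl).1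
      have hd := (ih w.dropLast.length (by rw [List.length_dropLast]; omega) w.dropLast rfl).1
      have hif : ∀ (p : Prop) [Decidable p] (v : Word), DifferentiableOn ℂ (polylog v) D0 →
          DifferentiableOn ℂ (fun z => if p then polylog v z else 0) D0 := fun p _ v hv => by
        by_cases h : p
        · simpa [h] using hv
        · simp [h]
      have hc : DifferentiableOn ℂ (polylogComm w) D0 := (hif _ _ ht).sub (hif _ _ hd)
      have hD : DifferentiableOn ℂ (polylogDeriv w) D0 :=
        ((Complex.differentiableOn_dslope D0_mem_nhds).mpr hc).add
          ((hif _ _ ht).div ((differentiableOn_const _).sub differentiableOn_id)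
            fun z hz => one_sub_ne_zero_of_mem_D0 hz)
      refine ⟨fun z hz => ?_, hc, hD⟩
      rw [polylog_of_ne_nil hw]
      exact (hasDerivAt_primitive hD hz).differentiableAt.differentiableWithinAt

theorem polylogDeriv_nil (z : ℂ) : polylogDeriv [] z = 0 := by
  have e1 : polylogComm [] = fun _ => 0 := funext fun z => by simp [polylogComm]
  rw [polylogDeriv, e1]
  by_cases h : z = 0
  · simp [h, dslope]
  · simp [h, dslope_of_ne, slope]

theorem hasDerivAt_polylog (w : Word) {z : ℂ} (hz : z ∈ D0) :
    HasDerivAt (polylog w) (polylogDeriv w z) z := by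
  by_cases hw : w = []
  · subst hw
    rw [polylogDeriv_nil, show polylog [] = fun _ => 1 from funext polylog_nil]
    exact hasDerivAt_const _ _
  · rw [polylog_of_ne_nil hw]
    exact hasDerivAt_primitive (differentiableOn_polylog w).2.2 hz

/-- For a single letter the two terms cancel or are both absent; for longer words they involve
nonempty words, whose polylogarithms vanish at `0`. -/
theorem polylogComm_zero (w : Word) : polylogComm w 0 = 0 := by
  rw [polylogComm]
  rcases w with _ | ⟨a, _ | ⟨b, w⟩⟩
  · simp
  · simp
  · rw [polylog_zero (w := (a :: b :: w).tail) (by simp),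
      polylog_zero (w := (a :: b :: w).dropLast) (by simp)]
    simp

theorem polylogDeriv_eq (w : Word) {z : ℂ} (hz : z ≠ 0) : polylogDeriv w z =
    polylogComm w z / z + (if w.head? = some 1 then polylog w.tail z else 0) / (1 - z) := by
  rw [polylogDeriv, dslope_of_ne _ hz, slope_def_field, polylogComm_zero, sub_zero, sub_zero]

open NCSeries

/-! ### Differential equations for series -/

/-- Coefficientwise derivative. -/
def HasCoeffDerivAt (F : ℂ → NCSeries ℂ) (F' : NCSeries ℂ) (z : ℂ) : Prop :=
  ∀ w, HasDerivAt (fun ζ => F ζ w) (F' w) z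

theorem HasCoeffDerivAt.mul {F G : ℂ → NCSeries ℂ} {F' G' : NCSeries ℂ} {z : ℂ}
    (hF : HasCoeffDerivAt F F' z) (hG : HasCoeffDerivAt G G' z) :
    HasCoeffDerivAt (fun ζ => F ζ * G ζ) (F' * G z + F z * G') z := fun w => by
  have h := HasDerivAt.fun_sum (u := Finset.range (w.length + 1)) fun i _ =>
    (hF (w.take i)).mul (hG (w.drop i))
  rw [Finset.sum_add_distrib] at h
  exact h

theorem hasCoeffDerivAt_const (F : NCSeries ℂ) (z : ℂ) : HasCoeffDerivAt (fun _ => F) 0 z :=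
  fun w => hasDerivAt_const z (F w)

theorem HasCoeffDerivAt.exp_smul_X {c : ℂ → ℂ} {c' z : ℂ} (hc : HasDerivAt c c' z) (a : Fin 2) :
    HasCoeffDerivAt (fun ζ => exp (c ζ • X a)) (c' • (X a * exp (c z • X a))) z := fun w => by
  rw [smul_apply, X_mul_apply]
  simp only [NCSeries.exp_smul_X]
  by_cases hw : w = List.replicate w.length a
  · generalize w.length = n at hw
    subst hw
    simp only [if_true]
    cases n with
    | zero => simpa using hasDerivAt_const z (1 : ℂ)
    | succ n =>
      refine ((hc.pow (n + 1)).div_const ((n + 1).factorial : ℂ)).congr_deriv ?_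
      have h1 : ((n : ℂ) + 1) ≠ 0 := by exact_mod_cast n.succ_ne_zero
      have h2 : (n.factorial : ℂ) ≠ 0 := by exact_mod_cast n.factorial_ne_zero
      simp only [List.replicate_succ, List.head?_cons, if_true, List.tail_cons,
        List.length_replicate, Nat.factorial_succ, Nat.add_sub_cancel]
      push_cast
      field_simp
  · simp only [if_neg hw]
    refine (hasDerivAt_const z (0 : ℂ)).congr_deriv (Eq.symm ?_)
    rcases w with _ | ⟨b, w⟩
    · simp
    · by_cases hb : b = a
      · rw [if_pos (by simp [hb]), if_neg, mul_zero]
        intro h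
        apply hw
        rw [List.length_cons, List.replicate_succ, hb]
        exact congrArg _ h
      · rw [if_neg (by simpa using hb), mul_zero]

theorem IsKZSolution.mul_const {G : ℂ → NCSeries ℂ} (hG : IsKZSolution G) (C : NCSeries ℂ) :
    IsKZSolution fun z => G z * C := fun z hz => by
  have h := HasCoeffDerivAt.mul (hG z hz) (hasCoeffDerivAt_const C z)
  rwa [mul_zero, add_zero, mul_assoc] at h

/-- A solution of the KZ equation is determined by its value at a point. -/
theorem IsKZSolution.eqOn {G H : ℂ → NCSeries ℂ} (hG : IsKZSolution G) (hH : IsKZSolution H)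
    {p : ℂ} (hp : p ∈ D0 ∩ D1) (h : G p = H p) {z : ℂ} (hz : z ∈ D0 ∩ D1) : G z = H z := by
  have hopen := isOpen_D0.inter isOpen_D1
  have key : ∀ (n : ℕ) (w : Word), w.length = n → ∀ z ∈ D0 ∩ D1, G z w = H z w := by
    intro n
    induction n using Nat.strong_induction_on with
    | _ n ih =>
      rintro w rfl z hz
      -- The equation is triangular: the derivative of the coefficient of `w` involves only the
      -- coefficient of `w.tail`.
      have hd : ∀ z ∈ D0 ∩ D1, HasDerivAt (fun ζ => G ζ w - H ζ w) 0 z := fun z hz => by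
        have h1 := (hG z hz w).sub (hH z hz w)
        refine h1.congr_deriv ?_
        simp only [add_mul, NCSeries.add_apply, NCSeries.smul_mul, NCSeries.smul_apply,
          X_mul_apply]
        rcases w with _ | ⟨b, w⟩
        · simp
        · rw [List.tail_cons, ih w.length (by simp) w rfl z hz, sub_self]
      have hc := hopen.is_const_of_deriv_eq_zero isPreconnected_D0_inter_D1
        (fun z hz => (hd z hz).differentiableAt.differentiableWithinAt)
        (fun z hz => (hd z hz).deriv) hz hp
      rw [h, sub_self] at hc
      exact sub_eq_zero.mp hc
  exact ext fun w => key _ w rfl z hz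

/-- Conjugating the KZ equation by the exponential of its singular part. -/
theorem kz_of_regularized {A B : ℂ → NCSeries ℂ} {a b : Fin 2} {p q z : ℂ}
    (hA : HasCoeffDerivAt A (p • (X a * A z - A z * X a) + q • (X b * A z)) z)
    (hB : HasCoeffDerivAt B (p • (X a * B z)) z) :
    HasCoeffDerivAt (fun ζ => A ζ * B ζ) ((p • X a + q • X b : NCSeries ℂ) * (A z * B z)) z := by
  refine fun w => (hA.mul hB w).congr_deriv (congrArg (fun F : NCSeries ℂ => F w) ?_)
  -- The term `-p A X_a B` of the commutator cancels the contribution of the derivative of `B`.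
  simp only [add_mul, NCSeries.smul_mul, mul_smul_comm', sub_mul, smul_sub, mul_assoc]
  abel

/-! ### The regularized solution at `0` -/

/-- The generating series of the regularized multiple polylogarithms. -/
noncomputable def polylogSeries (z : ℂ) : NCSeries ℂ := fun w => polylog w z

theorem polylogSeries_zero : polylogSeries 0 = 1 := ext fun w => by
  rw [one_apply]
  split_ifs with h
  · rw [h]; exact polylog_nil 0
  · exact polylog_zero h

theorem hasCoeffDerivAt_polylogSeries {z : ℂ} (hz : z ∈ D0) (hz0 : z ≠ 0) :
    HasCoeffDerivAt polylogSeries ((1 / z) • (X 0 * polylogSeries z - polylogSeries z * X 0) +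
      (1 / (1 - z)) • (X 1 * polylogSeries z)) z := fun w => by
  refine (hasDerivAt_polylog w hz).congr_deriv ?_
  rw [polylogDeriv_eq w hz0, NCSeries.add_apply, NCSeries.smul_apply, NCSeries.smul_apply,
    X_mul_apply, NCSeries.sub_apply, X_mul_apply, mul_X_apply, polylogComm,
    div_mul_eq_mul_div, one_mul, div_mul_eq_mul_div, one_mul]
  rfl

theorem hasDerivAt_pairing_polylogSeries (f : Shuffle) {z : ℂ} (hz : z ∈ D0) :
    HasDerivAt (fun ζ => pairing (polylogSeries ζ) f)
      (Shuffle.extend (fun w => polylogDeriv w z) f) z := by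
  refine Shuffle.IsSlice.induction_word (p := fun f => HasDerivAt
    (fun ζ => pairing (polylogSeries ζ) f) (Shuffle.extend (fun w => polylogDeriv w z) f) z) f
    (by simpa using hasDerivAt_const z (0 : ℂ)) fun w c g hg => ?_
  simp only [map_add, map_smul, Shuffle.extend_word, pairing_word, smul_eq_mul]
  exact ((hasDerivAt_polylog w hz).const_mul c).add hg

theorem extend_polylogDeriv (f : Shuffle) {z : ℂ} (hz : z ≠ 0) :
    Shuffle.extend (fun w => polylogDeriv w z) f =
      (1 / z) * (pairing (polylogSeries z) (Shuffle.stripFirst 0 f) -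
        pairing (polylogSeries z) (Shuffle.stripLast 0 f)) +
      (1 / (1 - z)) * pairing (polylogSeries z) (Shuffle.stripFirst 1 f) := by
  have e : Shuffle.extend (fun w => polylogDeriv w z) =
      (1 / z) • (pairing (polylogSeries z) ∘ₗ (Shuffle.stripFirst 0) -
        pairing (polylogSeries z) ∘ₗ (Shuffle.stripLast 0)) +
      (1 / (1 - z)) • pairing (polylogSeries z) ∘ₗ (Shuffle.stripFirst 1) :=
    Shuffle.hom_ext fun w => by
      have hs : ∀ (p : Prop) [Decidable p] (v : Word), pairing (polylogSeries z)
          (if p then Shuffle.word v else 0) = if p then polylog v z else 0 := fun p _ v => by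
        split_ifs
        · rw [pairing_word]; rfl
        · rw [map_zero]
      simp only [LinearMap.add_apply, LinearMap.smul_apply, LinearMap.sub_apply,
        LinearMap.comp_apply, Shuffle.stripFirst, Shuffle.stripLast, Shuffle.extend_word, hs,
        smul_eq_mul]
      rw [polylogDeriv_eq w hz, polylogComm]
      ring
  exact congrArg (fun m => m f) e

theorem stripFirst_word_eq (a : Fin 2) (u : Word) : Shuffle.stripFirst a (Shuffle.word u) = 0 ∨
    ∃ v : Word, v.length < u.length ∧ Shuffle.stripFirst a (Shuffle.word u) = Shuffle.word v := by
  rcases u with _ | ⟨b, u⟩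
  · left; simp [Shuffle.stripFirst]
  · by_cases h : b = a
    · exact Or.inr ⟨u, by simp, by simp [Shuffle.stripFirst, h]⟩
    · left; simp [Shuffle.stripFirst, h]

theorem stripLast_word_eq (a : Fin 2) (u : Word) : Shuffle.stripLast a (Shuffle.word u) = 0 ∨
    ∃ v : Word, v.length < u.length ∧ Shuffle.stripLast a (Shuffle.word u) = Shuffle.word v := by
  induction u using List.reverseRecOn with
  | nil => left; simp [Shuffle.stripLast]
  | append_singleton u b _ =>
    by_cases h : b = a
    · exact Or.inr ⟨u, by simp, by simp [Shuffle.stripLast, h]⟩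
    · left; simp [Shuffle.stripLast, h]

/-- The operators `stripFirst 0`, `stripLast 0` and `stripFirst 1` governing the differential
equation are all shuffle derivations. Hence the derivative of the left side follows the Leibniz
rule, with shuffles of smaller total length, and by induction it equals the derivative of the right
side. -/
theorem pairing_polylogSeries_mul (u v : Word) {z : ℂ} (hz : z ∈ D0) :
    pairing (polylogSeries z) (Shuffle.word u * Shuffle.word v) = polylog u z * polylog v z := by
  induction hn : u.length + v.length using Nat.strong_induction_on generalizing u v z with
  | _ n ih =>
    subst hn
    by_cases hu : u = []
    · rw [hu, ← Shuffle.one_def, one_mul, pairing_word, polylog_nil, one_mul]; rfl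
    by_cases hv : v = []
    · rw [hv, ← Shuffle.one_def, mul_one, pairing_word, polylog_nil, mul_one]; rfl
    have hw : ∀ w z, polylog w z = pairing (polylogSeries z) (Shuffle.word w) := fun w z => by
      rw [pairing_word]; rfl
    have hd : ∀ z ∈ D0, HasDerivAt (fun ζ => pairing (polylogSeries ζ)
        (Shuffle.word u * Shuffle.word v) - polylog u ζ * polylog v ζ)
        (Shuffle.extend (fun w => polylogDeriv w z) (Shuffle.word u * Shuffle.word v) -
          (polylogDeriv u z * polylog v z + polylog u z * polylogDeriv v z)) z := fun z hz =>
      (hasDerivAt_pairing_polylogSeries _ hz).sub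
        ((hasDerivAt_polylog u hz).mul (hasDerivAt_polylog v hz))
    have hL : ∀ (f : Shuffle), (f = 0 ∨ ∃ w : Word, w.length < u.length ∧ f = Shuffle.word w) →
        ∀ z ∈ D0, pairing (polylogSeries z) (f * Shuffle.word v) =
          pairing (polylogSeries z) f * polylog v z := by
      rintro f (rfl | ⟨w, hwl, rfl⟩) z hz
      · simp
      · rw [ih _ (by omega) w v hz rfl, hw w]
    have hR : ∀ (f : Shuffle), (f = 0 ∨ ∃ w : Word, w.length < v.length ∧ f = Shuffle.word w) →
        ∀ z ∈ D0, pairing (polylogSeries z) (Shuffle.word u * f) =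
          polylog u z * pairing (polylogSeries z) f := by
      rintro f (rfl | ⟨w, hwl, rfl⟩) z hz
      · simp
      · rw [ih _ (by omega) u w hz rfl, hw w]
    refine sub_eq_zero.mp (eq_zero_of_deriv_eq_zero isOpen_D0 isPreconnected_D0 zero_mem_D0
      (fun z hz => (hd z hz).differentiableAt.differentiableWithinAt) ?_ (fun z hz hz0 => ?_) hz)
    -- At `0` the series is `1`, whose pairing is the counit; this kills shuffles with a nonempty
    -- word.
    · rw [polylog_zero hu, zero_mul, sub_zero, polylogSeries_zero]
      have e : pairing 1 = Shuffle.counit := Shuffle.hom_ext fun w => by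
        rw [pairing_word, one_apply, Shuffle.counit, Shuffle.extend_word]
      obtain ⟨b, v, rfl⟩ := List.exists_cons_of_ne_nil hv
      rw [e, ← Shuffle.prepend_word, Shuffle.counit_mul_prepend]
    · rw [(hd z hz).deriv, ← Shuffle.extend_word (fun w => polylogDeriv w z) u,
        ← Shuffle.extend_word (fun w => polylogDeriv w z) v, extend_polylogDeriv _ hz0,
        extend_polylogDeriv _ hz0, extend_polylogDeriv _ hz0, Shuffle.stripFirst_mul,
        Shuffle.stripFirst_mul, Shuffle.stripLast_mul]
      simp only [map_add]
      rw [hL _ (stripFirst_word_eq 0 u) z hz, hL _ (stripFirst_word_eq 1 u) z hz,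
        hL _ (stripLast_word_eq 0 u) z hz, hR _ (stripFirst_word_eq 0 v) z hz,
        hR _ (stripFirst_word_eq 1 v) z hz, hR _ (stripLast_word_eq 0 v) z hz]
      ring

theorem isGrouplike_polylogSeries {z : ℂ} (hz : z ∈ D0) : IsGrouplike (polylogSeries z) :=
  (isGrouplike_iff _).mpr ⟨polylog_nil z, fun u v => by
    rw [← Shuffle.word_mul_word, pairing_polylogSeries_mul u v hz]; rfl⟩

/-- The coefficient of `X₀` cancels in `X₀ F - F X₀`. This is what places the series in the image of
`reg0`. -/
theorem polylog_singleton_zero {z : ℂ} (hz : z ∈ D0) : polylog [0] z = 0 := by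
  have h : ∀ z ∈ D0, HasDerivAt (polylog [0]) (polylogDeriv [0] z) z := fun z hz =>
    hasDerivAt_polylog [0] hz
  refine eq_zero_of_deriv_eq_zero isOpen_D0 isPreconnected_D0 zero_mem_D0
    (differentiableOn_polylog [0]).1 (polylog_zero (by simp))
    (fun z hz hz0 => ?_) hz
  rw [(h z hz).deriv, polylogDeriv_eq _ hz0, polylogComm]
  simp

theorem polylog_singleton_one {z : ℂ} (hz : z ∈ D0) : polylog [1] z = -Complex.log (1 - z) := by
  have h : ∀ z ∈ D0, HasDerivAt (fun ζ => polylog [1] ζ + Complex.log (1 - ζ))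
      (polylogDeriv [1] z + -1 / (1 - z)) z := fun z hz =>
    (hasDerivAt_polylog [1] hz).add
      (((hasDerivAt_id z).const_sub 1).clog ((mem_D0_iff z).mp hz))
  refine eq_neg_of_add_eq_zero_left (eq_zero_of_deriv_eq_zero isOpen_D0
    isPreconnected_D0 zero_mem_D0 (fun z hz => (h z hz).differentiableAt.differentiableWithinAt)
    (by simp [polylog_zero]) (fun z hz hz0 => ?_) hz)
  rw [(h z hz).deriv, polylogDeriv_eq _ hz0, polylogComm]
  simp [polylog_nil]
  ring

/-! ### The regularized solution at `1` -/

theorem negFlip_add (F G : NCSeries ℂ) : negFlip (F + G) = negFlip F + negFlip G :=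
  ext fun w => by rw [NCSeries.add_apply]; simp only [negFlip]; rw [NCSeries.add_apply]; ring

theorem negFlip_X_mul (a : Fin 2) (F : NCSeries ℂ) :
    negFlip (X a * F) = -(X a.rev * negFlip F) := ext fun w => by
  rw [NCSeries.neg_apply, X_mul_apply, negFlip, X_mul_apply]
  rcases w with _ | ⟨b, w⟩
  · simp [flipWord]
  · by_cases h : b = a.rev
    · simp [flipWord, negFlip, h, pow_succ]
    · have h' : ¬ b.rev = a := fun h' => h (by rw [← h', Fin.rev_rev])
      simp [flipWord, h, h']

theorem negFlip_mul_X (a : Fin 2) (F : NCSeries ℂ) :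
    negFlip (F * X a) = -(negFlip F * X a.rev) := ext fun w => by
  rw [NCSeries.neg_apply, mul_X_apply, negFlip, mul_X_apply]
  induction w using List.reverseRecOn with
  | nil => simp [flipWord]
  | append_singleton w b _ =>
    by_cases h : b = a.rev
    · simp [flipWord, negFlip, h, pow_succ]
    · have h' : ¬ b.rev = a := fun h' => h (by rw [← h', Fin.rev_rev])
      simp [flipWord, h, h']

/-- The generating series of the regularized multiple polylogarithms at `1 - z`, with `X₀` and `X₁`
replaced by `-X₁` and `-X₀`. -/
noncomputable def dualPolylogSeries (z : ℂ) : NCSeries ℂ := negFlip (polylogSeries (1 - z))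

theorem dualPolylogSeries_one : dualPolylogSeries 1 = 1 := ext fun w => by
  rw [dualPolylogSeries, sub_self, polylogSeries_zero, negFlip, one_apply, one_apply]
  by_cases h : w = [] <;> simp [h, flipWord]

theorem hasCoeffDerivAt_dualPolylogSeries {z : ℂ} (hz : z ∈ D1) (hz0 : 1 - z ≠ 0) :
    HasCoeffDerivAt dualPolylogSeries
      ((1 / (1 - z)) • (X 1 * dualPolylogSeries z - dualPolylogSeries z * X 1) +
      (1 / z) • (X 0 * dualPolylogSeries z)) z := fun w => by
  have h := ((hasCoeffDerivAt_polylogSeries ((one_sub_mem_D0_iff z).mpr hz) hz0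
    (flipWord w)).scomp z ((hasDerivAt_id z).const_sub 1)).const_mul ((-1 : ℂ) ^ w.length)
  refine h.congr_deriv (Eq.symm ?_)
  set S := polylogSeries (1 - z) with hS
  -- The minus sign from differentiating `1 - z` compensates the one each variable acquires under
  -- `negFlip`.
  have e : (1 / (1 - z)) • (X 1 * dualPolylogSeries z - dualPolylogSeries z * X 1) +
      (1 / z) • (X 0 * dualPolylogSeries z) =
      -negFlip ((1 / (1 - z)) • (X 0 * S - S * X 0) + (1 / (1 - (1 - z))) • (X 1 * S)) := by
    have hsm : ∀ (c : ℂ) F, negFlip (c • F) = c • negFlip F := fun c F => ext fun w => by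
      rw [NCSeries.smul_apply]; simp only [negFlip]; rw [NCSeries.smul_apply]; ring
    have hng : ∀ F, negFlip (-F) = -negFlip F := fun F => ext fun w => by
      change _ * -_ = -(_ * _)
      ring
    rw [negFlip_add, hsm, hsm, sub_eq_add_neg (X 0 * S), negFlip_add, hng, negFlip_X_mul,
      negFlip_X_mul, negFlip_mul_X, sub_sub_cancel, show dualPolylogSeries z = negFlip S from rfl,
      show (Fin.rev 0 : Fin 2) = 1 from rfl, show (Fin.rev 1 : Fin 2) = 0 from rfl, neg_add,
      ← smul_neg, ← smul_neg, neg_neg, neg_add, neg_neg, neg_neg, sub_eq_add_neg (X 1 * _)]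
  rw [e]
  change -(_ * _) = _
  simp

theorem isGrouplike_dualPolylogSeries {z : ℂ} (hz : z ∈ D1) :
    IsGrouplike (dualPolylogSeries z) :=
  (isGrouplike_polylogSeries ((one_sub_mem_D0_iff z).mpr hz)).negFlip

theorem dualPolylogSeries_singleton {z : ℂ} (hz : z ∈ D1) : dualPolylogSeries z [1] = 0 := by
  have h := polylog_singleton_zero ((one_sub_mem_D0_iff z).mpr hz)
  change (-1) ^ 1 * polylog [Fin.rev 1] (1 - z) = 0
  rw [show (Fin.rev 1 : Fin 2) = 0 from rfl, h, mul_zero]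

theorem isKZSolution_polylogSeries : IsKZSolution fun z => polylogSeries z * powX0 z := by
  intro z hz
  have hz0 := ne_zero_of_mem_D1 hz.2
  refine kz_of_regularized (hasCoeffDerivAt_polylogSeries hz.1 hz0) ?_
  rw [one_div]
  exact HasCoeffDerivAt.exp_smul_X (Complex.hasDerivAt_log ((mem_D1_iff z).mp hz.2)) 0

theorem isKZSolution_dualPolylogSeries :
    IsKZSolution fun z => dualPolylogSeries z * powNegX1 z := by
  intro z hz
  have hz0 := one_sub_ne_zero_of_mem_D0 hz.1
  rw [add_comm]
  refine kz_of_regularized (hasCoeffDerivAt_dualPolylogSeries hz.2 hz0) ?_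
  have h := (((hasDerivAt_id z).const_sub 1).clog ((mem_D0_iff z).mp hz.1)).neg
  rw [id, ← neg_div, neg_neg] at h
  exact HasCoeffDerivAt.exp_smul_X h 1

/-! ### Growth of the regularized multiple polylogarithms -/

/-- Near `0` the formula with `1/z` gives no estimate, so compactness is used there. -/
theorem exists_bound_polylogDeriv_near_zero (w : Word) :
    ∃ K : ℝ, 0 ≤ K ∧ ∀ z : ℂ, ‖z‖ ≤ 1 / 2 → ‖(1 - z) * polylogDeriv w z‖ ≤ K := by
  have hc : ContinuousOn (fun z => (1 - z) * polylogDeriv w z) (Metric.closedBall 0 (1 / 2)) :=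
    ((continuous_const.sub continuous_id).continuousOn).mul
      ((differentiableOn_polylog w).2.2.continuousOn.mono fun z hz =>
        mem_D0_of_norm_lt_one (by
          rw [mem_closedBall_zero_iff] at hz
          linarith))
  obtain ⟨K, hK⟩ := (isCompact_closedBall (0 : ℂ) (1 / 2)).exists_bound_of_continuousOn hc
  refine ⟨K, (norm_nonneg _).trans (hK 0 (by simp)), fun z hz => hK z ?_⟩
  rwa [mem_closedBall_zero_iff]

/-- Integrate along the path `t ↦ 1 - exp(t L) = 1 - (1-z)^t` from `0` to `z`, where `L = log(1-z)`.
Its velocity is `-exp(t L) L`, and `exp(t L)` is exactly the factor `1 - ζ` at the point `ζ` of the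
path; the logarithm there is `t L`. So the integrand is at most `K (1+|L|)^m |L|`. -/
theorem norm_polylog_le {w : Word} (hw : w ≠ []) {K : ℝ} {m : ℕ}
    (h : ∀ z ∈ D0, ‖(1 - z) * polylogDeriv w z‖ ≤ K * (1 + ‖Complex.log (1 - z)‖) ^ m)
    {z : ℂ} (hz : z ∈ D0) : ‖polylog w z‖ ≤ K * (1 + ‖Complex.log (1 - z)‖) ^ (m + 1) := by
  have hK : 0 ≤ K := by simpa using (norm_nonneg _).trans (h 0 zero_mem_D0)
  set L := Complex.log (1 - z) with hL
  have hz1 := one_sub_ne_zero_of_mem_D0 hz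
  have hLim : |L.im| < Real.pi := by
    have h := Complex.mem_slitPlane_iff_arg.mp ((mem_D0_iff z).mp hz)
    rw [hL, Complex.log_im, abs_lt]
    exact ⟨Complex.neg_pi_lt_arg _, lt_of_le_of_ne (Complex.arg_le_pi _) h.1⟩
  -- Scaling by `t` keeps the imaginary part strictly inside `(-π, π)`, so the path stays in `D0`
  -- and on the principal branch.
  have hlog : ∀ t ∈ Set.Icc (0 : ℝ) 1, Complex.log (Complex.exp (t * L)) = t * L ∧
      1 - Complex.exp (t * L) ∈ D0 := fun t ht => by
    have him : |(t * L).im| < Real.pi := by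
      rw [Complex.im_ofReal_mul, abs_mul,
        abs_of_nonneg ht.1]
      exact (mul_le_of_le_one_left (abs_nonneg _) ht.2).trans_lt hLim
    rw [abs_lt] at him
    have e := Complex.log_exp him.1 him.2.le
    refine ⟨e, ?_⟩
    rw [mem_D0_iff, sub_sub_cancel, Complex.mem_slitPlane_iff_arg]
    refine ⟨?_, Complex.exp_ne_zero _⟩
    rw [← Complex.log_im, e]
    exact him.2.ne
  have hder : ∀ t ∈ Set.Icc (0 : ℝ) 1, HasDerivAt (fun s : ℝ => polylog w (1 - Complex.exp (s * L)))
      (polylogDeriv w (1 - Complex.exp (t * L)) * -(Complex.exp (t * L) * L)) t := fun t ht => by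
    have h1 : HasDerivAt (fun s : ℂ => 1 - Complex.exp (s * L)) (-(Complex.exp (t * L) * L))
        (t : ℂ) := by
      have := (((hasDerivAt_id (t : ℂ)).mul_const L).cexp).const_sub 1
      simpa using this
    exact (HasDerivAt.comp (t : ℂ) (hasDerivAt_polylog w (hlog t ht).2) h1).comp_ofReal
  have hb := norm_image_sub_le_of_norm_deriv_le_segment_01' (C := K * (1 + ‖L‖) ^ m * ‖L‖)
    (fun t ht => (hder t ht).hasDerivWithinAt) fun t ht => by
      have ht' : t ∈ Set.Icc (0 : ℝ) 1 := ⟨ht.1, ht.2.le⟩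
      have h1 := h _ (hlog t ht').2
      rw [sub_sub_cancel, (hlog t ht').1] at h1
      rw [mul_neg, norm_neg, mul_comm, mul_right_comm, norm_mul]
      gcongr
      refine h1.trans ?_
      gcongr
      rw [norm_mul, Complex.norm_real, Real.norm_of_nonneg ht.1]
      exact mul_le_of_le_one_left (norm_nonneg _) ht.2.le
  simp only [Complex.ofReal_one, one_mul, Complex.ofReal_zero, zero_mul, Complex.exp_zero,
    sub_self] at hb
  rw [hL, Complex.exp_log hz1, sub_sub_cancel, polylog_zero hw, sub_zero, ← hL] at hb
  refine hb.trans ?_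
  rw [pow_succ, ← mul_assoc]
  gcongr
  linarith

/-- Away from `0`, `(1-z) f_w'` is a bounded combination of polylogarithms of words shorter by one
letter; integration by `norm_polylog_le` costs one more power of the logarithm. -/
theorem exists_bound_polylog (w : Word) : ∃ C : ℝ, ∀ z ∈ D0,
    ‖polylog w z‖ ≤ C * (1 + ‖Complex.log (1 - z)‖) ^ w.length ∧
    ‖(1 - z) * polylogDeriv w z‖ ≤ C * (1 + ‖Complex.log (1 - z)‖) ^ w.length := by
  induction hn : w.length using Nat.strong_induction_on generalizing w with
  | _ n ih =>
    subst hn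
    by_cases hw : w = []
    · subst hw
      exact ⟨1, fun z _ => by simp [polylog_nil, polylogDeriv_nil]⟩
    obtain ⟨m, hm⟩ : ∃ m, w.length = m + 1 :=
      Nat.exists_eq_succ_of_ne_zero (List.length_pos_of_ne_nil hw).ne'
    obtain ⟨C₁, h₁⟩ := ih m (by omega) w.tail (by simp [hm])
    obtain ⟨C₂, h₂⟩ := ih m (by omega) w.dropLast (by simp [hm])
    obtain ⟨K, hK, hK'⟩ := exists_bound_polylogDeriv_near_zero w
    have hC₁ : 0 ≤ C₁ := by simpa using (norm_nonneg _).trans (h₁ 0 zero_mem_D0).1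
    have hC₂ : 0 ≤ C₂ := by simpa using (norm_nonneg _).trans (h₂ 0 zero_mem_D0).1
    have hif : ∀ (p : Prop) [Decidable p] (v : Word) (C B : ℝ) (z : ℂ), 0 ≤ C * B →
        ‖polylog v z‖ ≤ C * B → ‖if p then polylog v z else 0‖ ≤ C * B := fun p _ v C B z h0 h => by
      split_ifs
      · exact h
      · simpa using h0
    -- `K` serves for `|z| ≤ 1/2`. Elsewhere `|1/z - 1| ≤ 3` multiplies the commutator, bounded by
    -- `C₁ + C₂`, and the term in `1/(1-z)` adds another `C₁`.
    have key : ∀ z ∈ D0, ‖(1 - z) * polylogDeriv w z‖ ≤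
        (K + 4 * C₁ + 3 * C₂) * (1 + ‖Complex.log (1 - z)‖) ^ m := fun z hz => by
      set A := (1 + ‖Complex.log (1 - z)‖) ^ m with hA
      have hA1 : 1 ≤ A := one_le_pow₀ (by linarith [norm_nonneg (Complex.log (1 - z))])
      have hA0 : 0 ≤ A := by linarith
      by_cases hz2 : ‖z‖ ≤ 1 / 2
      · refine (hK' z hz2).trans ?_
        nlinarith [mul_nonneg hC₁ hA0, mul_nonneg hC₂ hA0]
      · push Not at hz2
        have hz0 : z ≠ 0 := fun h => by rw [h, norm_zero] at hz2; linarith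
        have hz1 := one_sub_ne_zero_of_mem_D0 hz
        have e : (1 - z) * polylogDeriv w z = (1 / z - 1) * polylogComm w z +
            if w.head? = some 1 then polylog w.tail z else 0 := by
          rw [polylogDeriv_eq w hz0]
          field_simp
        have e1 : ‖1 / z - 1‖ ≤ 3 := by
          refine (norm_sub_le _ _).trans ?_
          rw [norm_div, norm_one]
          have : 1 / ‖z‖ ≤ 2 := by
            rw [div_le_iff₀ (by linarith)]
            linarith
          linarith
        have e2 : ‖polylogComm w z‖ ≤ C₁ * A + C₂ * A :=
          (norm_sub_le _ _).trans (add_le_add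
            (hif _ _ _ _ _ (mul_nonneg hC₁ hA0) (h₁ z hz).1)
            (hif _ _ _ _ _ (mul_nonneg hC₂ hA0) (h₂ z hz).1))
        have e3 : ‖if w.head? = some 1 then polylog w.tail z else 0‖ ≤ C₁ * A :=
          hif _ _ _ _ _ (mul_nonneg hC₁ hA0) (h₁ z hz).1
        rw [e]
        refine (norm_add_le _ _).trans ?_
        rw [norm_mul]
        have e4 := mul_le_mul e1 e2 (norm_nonneg _) (by norm_num)
        nlinarith [mul_nonneg hK hA0]
    refine ⟨K + 4 * C₁ + 3 * C₂, fun z hz => ⟨?_, (key z hz).trans ?_⟩⟩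
    · rw [hm]
      exact norm_polylog_le hw key hz
    · have : 1 ≤ 1 + ‖Complex.log (1 - z)‖ := by linarith [norm_nonneg (Complex.log (1 - z))]
      rw [hm]
      gcongr
      omega

/-- Used at infinity for the decay of derivatives and, after inversion, at `0` to compare logarithms
with powers. -/
theorem tendsto_log_pow_div (n : ℕ) : Tendsto
    (fun z : ℂ => (1 + ‖Complex.log z‖) ^ n / ‖z‖) (Bornology.cobounded ℂ) (𝓝 0) := by
  have h1 : Tendsto (fun x : ℝ => 2 ^ n * (Real.log x ^ n / x)) atTop (𝓝 0) := by
    simpa using (Real.isLittleO_pow_log_id_atTop (n := n)).tendsto_div_nhds_zero.const_mul (2 ^ n)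
  have h2 := h1.comp (tendsto_norm_cobounded_atTop (E := ℂ))
  refine squeeze_zero' (Eventually.of_forall fun z => by positivity) ?_ h2
  -- Beyond this threshold `1 + |log z| ≤ 1 + π + log |z| ≤ 2 log |z|`, whence the factor `2 ^ n`.
  have h3 : ∀ᶠ x : ℝ in atTop, 1 + Real.pi ≤ Real.log x :=
    Real.tendsto_log_atTop.eventually_ge_atTop _
  filter_upwards [(tendsto_norm_cobounded_atTop (E := ℂ)).eventually h3] with z hz
  have h4 : ‖Complex.log z‖ ≤ Real.log ‖z‖ + Real.pi := by
    refine (Complex.norm_le_abs_re_add_abs_im _).trans ?_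
    rw [Complex.log_re, Complex.log_im]
    have : 0 ≤ Real.log ‖z‖ := by linarith [Real.pi_pos]
    rw [abs_of_nonneg this]
    exact add_le_add le_rfl (Complex.abs_arg_le_pi z)
  simp only [Function.comp]
  rw [← mul_div_assoc, ← mul_pow]
  gcongr
  linarith

theorem derivTendstoZero_polylogSeries : DerivTendstoZero polylogSeries D0 := fun w => by
  obtain ⟨C, hC⟩ := exists_bound_polylog w
  have h1 : Tendsto (fun z : ℂ => 1 - z) (Bornology.cobounded ℂ ⊓ 𝓟 D0)
      (Bornology.cobounded ℂ) := by
    refine Tendsto.mono_left ?_ inf_le_left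
    rw [← tendsto_norm_atTop_iff_cobounded]
    refine tendsto_atTop_mono (fun z => ?_)
      (tendsto_atTop_add_const_right _ (-1) tendsto_norm_cobounded_atTop)
    rw [norm_sub_rev]
    have := norm_sub_norm_le z 1
    rw [norm_one] at this
    linarith
  have h2 := ((tendsto_log_pow_div w.length).comp h1).const_mul C
  rw [mul_zero] at h2
  refine squeeze_zero_norm' ?_ h2
  filter_upwards [mem_inf_of_right (mem_principal_self D0)] with z hz
  have h3 := (hC z hz).2
  have hz1 : 0 < ‖1 - z‖ := norm_pos_iff.mpr (one_sub_ne_zero_of_mem_D0 hz)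
  rw [show (fun ζ => polylogSeries ζ w) = polylog w from rfl, (hasDerivAt_polylog w hz).deriv]
  simp only [Function.comp]
  rw [← mul_div_assoc, le_div_iff₀ hz1, ← norm_mul, mul_comm]
  exact h3

theorem derivTendstoZero_dualPolylogSeries : DerivTendstoZero dualPolylogSeries D1 := fun w => by
  have h1 : Tendsto (fun z : ℂ => 1 - z) (Bornology.cobounded ℂ ⊓ 𝓟 D1)
      (Bornology.cobounded ℂ ⊓ 𝓟 D0) := by
    refine tendsto_inf.mpr ⟨Tendsto.mono_left ?_ inf_le_left, tendsto_principal.mpr ?_⟩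
    · rw [← tendsto_norm_atTop_iff_cobounded]
      refine tendsto_atTop_mono (fun z => ?_)
        (tendsto_atTop_add_const_right _ (-1) tendsto_norm_cobounded_atTop)
      rw [norm_sub_rev]
      have := norm_sub_norm_le z 1
      rw [norm_one] at this
      linarith
    · filter_upwards [mem_inf_of_right (mem_principal_self D1)] with z hz
      exact (one_sub_mem_D0_iff z).mpr hz
  have h2 := ((derivTendstoZero_polylogSeries (flipWord w)).comp h1).const_mul
    (-(-1 : ℂ) ^ w.length)
  rw [mul_zero] at h2
  refine h2.congr fun z => ?_
  change _ = deriv (fun ζ => (-1 : ℂ) ^ w.length * polylog (flipWord w) (1 - ζ)) z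
  rw [deriv_const_mul_field, deriv_comp_const_sub]
  simp only [Function.comp]
  rw [mul_neg, neg_mul]
  rfl

theorem holomorphicOn_polylogSeries : HolomorphicOn polylogSeries D0 := fun w =>
  (differentiableOn_polylog w).1

theorem holomorphicOn_dualPolylogSeries : HolomorphicOn dualPolylogSeries D1 := fun w =>
  ((differentiableOn_polylog (flipWord w)).1.comp
    ((differentiableOn_const 1).sub differentiableOn_id)
    fun z hz => (one_sub_mem_D0_iff z).mpr hz).const_mul _

/-! ### Uniqueness -/

/-- Since `D0 ∪ D1` is the whole plane, the two functions glue to an entire function. Its derivative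
is entire and tends to `0` at infinity, so it vanishes by Liouville. -/
theorem eqOn_zero_of_tendsto_deriv {d₀ d₁ : ℂ → ℂ} (h₀ : DifferentiableOn ℂ d₀ D0)
    (h₁ : DifferentiableOn ℂ d₁ D1) (h : ∀ z ∈ D0 ∩ D1, d₀ z = d₁ z)
    (ht₀ : Tendsto (deriv d₀) (Bornology.cobounded ℂ ⊓ 𝓟 D0) (𝓝 0))
    (ht₁ : Tendsto (deriv d₁) (Bornology.cobounded ℂ ⊓ 𝓟 D1) (𝓝 0)) (h0 : d₀ 0 = 0) :
    (∀ z ∈ D0, d₀ z = 0) ∧ ∀ z ∈ D1, d₁ z = 0 := by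
  classical
  set g : ℂ → ℂ := fun z => if z ∈ D0 then d₀ z else d₁ z with hg
  have hg0 : ∀ z ∈ D0, g z = d₀ z := fun z hz => if_pos hz
  have hg1 : ∀ z ∈ D1, g z = d₁ z := fun z hz => by
    by_cases hz' : z ∈ D0
    · rw [hg0 z hz', h z ⟨hz', hz⟩]
    · exact if_neg hz'
  have he0 : ∀ z ∈ D0, g =ᶠ[𝓝 z] d₀ := fun z hz => by
    filter_upwards [isOpen_D0.mem_nhds hz] using hg0
  have he1 : ∀ z ∈ D1, g =ᶠ[𝓝 z] d₁ := fun z hz => by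
    filter_upwards [isOpen_D1.mem_nhds hz] using hg1
  have hgd : Differentiable ℂ g := fun z => by
    rcases mem_D0_or_mem_D1 z with hz | hz
    · exact (h₀.differentiableAt (isOpen_D0.mem_nhds hz)).congr_of_eventuallyEq (he0 z hz)
    · exact (h₁.differentiableAt (isOpen_D1.mem_nhds hz)).congr_of_eventuallyEq (he1 z hz)
  have ht : Tendsto (deriv g) (Filter.cocompact ℂ) (𝓝 0) := by
    have hu : D0 ∪ D1 = Set.univ := Set.eq_univ_of_forall mem_D0_or_mem_D1
    rw [← Metric.cobounded_eq_cocompact, ← inf_top_eq (Bornology.cobounded ℂ), ← principal_univ,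
      ← hu, ← sup_principal, inf_sup_left]
    refine Tendsto.sup (ht₀.congr' ?_) (ht₁.congr' ?_)
    · filter_upwards [mem_inf_of_right (mem_principal_self D0)] with z hz
      exact (he0 z hz).deriv_eq.symm
    · filter_upwards [mem_inf_of_right (mem_principal_self D1)] with z hz
      exact (he1 z hz).deriv_eq.symm
  have hd : deriv g = fun _ => 0 :=
    (hgd.contDiff (n := 2)).differentiable_deriv_two.eq_const_of_tendsto_cocompact ht
  have hz : ∀ z, g z = 0 := fun z => by
    rw [is_const_of_deriv_eq_zero hgd (fun x => congrFun hd x) z 0, hg0 0 zero_mem_D0, h0]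
  exact ⟨fun z hz' => by rw [← hg0 z hz', hz], fun z hz' => by rw [← hg1 z hz', hz]⟩

theorem IsRHSolution.eq_mul {F0 F1 : ℂ → NCSeries ℂ} (h : IsRHSolution F0 F1) {z : ℂ}
    (hz : z ∈ D0 ∩ D1) : F0 z = F1 z * (powNegX1 z * PhiKZ * powNegX0 z) := by
  rw [← h.rel z hz, Ring.mul_inverse_cancel_left _ _ (isUnit_of_nil (h.grouplike1 z hz.2).1)]

/-- In `F0 = F1 Q` with `Q` of constant term `1`, the coefficient of `w` in `F0` is that of `F1`
plus terms in shorter words. Once shorter words agree, the differences at `w` coincide on `D0 ∩ D1`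
and `eqOn_zero_of_tendsto_deriv` applies. -/
theorem IsRHSolution.eqOn {F0 F1 G0 G1 : ℂ → NCSeries ℂ} (hF : IsRHSolution F0 F1)
    (hG : IsRHSolution G0 G1) : Set.EqOn F0 G0 D0 ∧ Set.EqOn F1 G1 D1 := by
  have key : ∀ (n : ℕ) (w : Word), w.length = n →
      (∀ z ∈ D0, F0 z w - G0 z w = 0) ∧ ∀ z ∈ D1, F1 z w - G1 z w = 0 := by
    intro n
    induction n using Nat.strong_induction_on with
    | _ n ih =>
      rintro w rfl
      refine eqOn_zero_of_tendsto_deriv ((hF.holo0 w).sub (hG.holo0 w))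
        ((hF.holo1 w).sub (hG.holo1 w)) (fun z hz => ?_) ?_ ?_ ?_
      -- The constant term is read off from the relation itself, both solutions having constant term
      -- `1`.
      · have hQ : (powNegX1 z * PhiKZ * powNegX0 z) [] = 1 := by
          have h := congrArg (fun F : NCSeries ℂ => F []) (hF.eq_mul hz)
          beta_reduce at h
          rw [mul_nil (F1 z), (hF.grouplike0 z hz.1).1, (hF.grouplike1 z hz.2).1, one_mul] at h
          exact h.symm
        rw [hF.eq_mul hz, hG.eq_mul hz, mul_apply, mul_apply, Finset.sum_range_succ,
          Finset.sum_range_succ, List.take_length, List.drop_length, hQ, mul_one, mul_one,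
          add_sub_add_comm, ← Finset.sum_sub_distrib, Finset.sum_eq_zero, zero_add]
        intro i hi
        rw [Finset.mem_range] at hi
        rw [← sub_mul, (ih _ (by simpa using hi) (w.take i) rfl).2 z hz.2, zero_mul]
      · have h := (hF.asymp0 w).sub (hG.asymp0 w)
        rw [sub_zero] at h
        refine h.congr' ?_
        filter_upwards [mem_inf_of_right (mem_principal_self D0)] with z hz
        exact (deriv_fun_sub ((hF.holo0 w).differentiableAt (isOpen_D0.mem_nhds hz))
          ((hG.holo0 w).differentiableAt (isOpen_D0.mem_nhds hz))).symm
      · have h := (hF.asymp1 w).sub (hG.asymp1 w)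
        rw [sub_zero] at h
        refine h.congr' ?_
        filter_upwards [mem_inf_of_right (mem_principal_self D1)] with z hz
        exact (deriv_fun_sub ((hF.holo1 w).differentiableAt (isOpen_D1.mem_nhds hz))
          ((hG.holo1 w).differentiableAt (isOpen_D1.mem_nhds hz))).symm
      · rw [hF.norm0, hG.norm0, sub_self]
  exact ⟨fun z hz => ext fun w => sub_eq_zero.mp ((key _ w rfl).1 z hz),
    fun z hz => ext fun w => sub_eq_zero.mp ((key _ w rfl).2 z hz)⟩

/-! ### Power series of multiple polylogarithms -/

/-- The Taylor coefficients of the multiple polylogarithms of words not ending in `0`. -/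
noncomputable def liCoeff : Word → ℕ → ℝ
  | [], n => if n = 0 then 1 else 0
  -- For `n = 0` the division by zero returns `0`, the correct constant term for a nonempty word.
  | 0 :: w, n => liCoeff w n / n
  | 1 :: w, n => (∑ m ∈ Finset.range n, liCoeff w m) / n

theorem liCoeff_nonneg (w : Word) (n : ℕ) : 0 ≤ liCoeff w n := by
  induction w generalizing n with
  | nil => rw [liCoeff]; split_ifs <;> norm_num
  | cons a w ih =>
    fin_cases a
    · exact div_nonneg (ih n) n.cast_nonneg
    · exact div_nonneg (Finset.sum_nonneg fun m _ => ih m) n.cast_nonneg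

theorem liCoeff_cons_zero (a : Fin 2) (w : Word) : liCoeff (a :: w) 0 = 0 := by
  fin_cases a <;> simp [liCoeff]

/-- With `s = √n` and `t = √(n+1)`, the identity `t² - s² = 1` turns `1/t ≤ 2(t - s)` into `(t - s)²
≥ 0`. The term `m = 0` is `1/0 = 0`. -/
theorem sum_one_div_sqrt_le (n : ℕ) :
    ∑ m ∈ Finset.range (n + 1), 1 / Real.sqrt m ≤ 2 * Real.sqrt n := by
  induction n with
  | zero => simp
  | succ n ih =>
    rw [Finset.sum_range_succ]
    refine (add_le_add ih le_rfl).trans ?_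
    have hs := Real.sqrt_nonneg (n : ℝ)
    have ht : 0 < Real.sqrt ((n + 1 : ℕ) : ℝ) := Real.sqrt_pos.mpr (by positivity)
    have hs2 := Real.sq_sqrt (n.cast_nonneg : (0 : ℝ) ≤ n)
    have ht2 := Real.sq_sqrt ((n + 1).cast_nonneg : (0 : ℝ) ≤ (n + 1 : ℕ))
    set s := Real.sqrt (n : ℝ)
    set t := Real.sqrt ((n + 1 : ℕ) : ℝ)
    push_cast at ht2
    have h1 : 1 / t ≤ 2 * t - 2 * s := by
      rw [div_le_iff₀ ht]
      nlinarith [sq_nonneg (t - s)]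
    linarith

theorem getLast?_tail_ne {a : Fin 2} {w : Word} (h : (a :: w).getLast? ≠ some 0) :
    w.getLast? ≠ some 0 := by
  cases w with
  | nil => simp
  | cons b w => rwa [List.getLast?_cons_cons] at h

/-- The order `1/√n` is not sharp, but it is stable under both recursion steps: dividing by `n` only
helps, and averaging `1/√m` over `m < n` at most doubles the constant. A leading `0` then gives
`n^{-3/2}`, which is summable. -/
theorem exists_liCoeff_le {w : Word} (hw : w ≠ []) (h : w.getLast? ≠ some 0) :
    ∃ C : ℝ, 0 ≤ C ∧ ∀ n : ℕ, liCoeff w n ≤ C * (1 / Real.sqrt n) := by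
  induction w with
  | nil => exact absurd rfl hw
  | cons a w ih =>
    have h' := getLast?_tail_ne h
    have hroot : ∀ n : ℕ, 1 ≤ n → (1 : ℝ) / n ≤ 1 / Real.sqrt n := fun n hn => by
      have hn' : (1 : ℝ) ≤ n := by exact_mod_cast hn
      refine one_div_le_one_div_of_le (Real.sqrt_pos.mpr (by linarith)) ?_
      rw [Real.sqrt_le_left (by linarith)]
      nlinarith
    by_cases hw' : w = []
    · subst hw'
      have ha : a = 1 := by
        have : a ≠ 0 := by simpa using h
        omega
      subst ha
      refine ⟨1, zero_le_one, fun n => ?_⟩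
      rw [one_mul, liCoeff]
      rcases n with _ | n
      · simp
      · rw [Finset.sum_eq_single 0 (fun m _ hm => by simp [liCoeff, hm]) (by simp)]
        simpa [liCoeff] using hroot (n + 1) (by omega)
    · obtain ⟨C, hC, hb⟩ := ih hw' h'
      fin_cases a
      · refine ⟨C, hC, fun n => ?_⟩
        change liCoeff w n / n ≤ _
        rcases n with _ | n
        · simp
        · refine (div_le_self (liCoeff_nonneg w _) ?_).trans (hb _)
          exact_mod_cast Nat.succ_le_succ n.zero_le
      · refine ⟨2 * C, by positivity, fun n => ?_⟩
        change (∑ m ∈ Finset.range n, liCoeff w m) / n ≤ _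
        rcases n with _ | n
        · simp
        · have h1 : ∑ m ∈ Finset.range (n + 1), liCoeff w m ≤ C * (2 * Real.sqrt (n + 1 : ℕ)) := by
            refine (Finset.sum_le_sum fun m _ => hb m).trans ?_
            rw [← Finset.mul_sum]
            refine mul_le_mul_of_nonneg_left ((sum_one_div_sqrt_le n).trans ?_) hC
            gcongr
            omega
          have hn : (0 : ℝ) < (n + 1 : ℕ) := by positivity
          have hs : 0 < Real.sqrt (n + 1 : ℕ) := Real.sqrt_pos.mpr hn
          rw [div_le_iff₀ hn]
          refine h1.trans (le_of_eq ?_)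
          have := Real.mul_self_sqrt hn.le
          field_simp
          rw [sq, this]

theorem exists_liCoeff_le_const {w : Word} (h : w.getLast? ≠ some 0) :
    ∃ C : ℝ, 0 ≤ C ∧ ∀ n : ℕ, liCoeff w n ≤ C := by
  by_cases hw : w = []
  · exact ⟨1, zero_le_one, fun n => by rw [hw, liCoeff]; split_ifs <;> norm_num⟩
  · obtain ⟨C, hC, hb⟩ := exists_liCoeff_le hw h
    refine ⟨C, hC, fun n => (hb n).trans (mul_le_of_le_one_right hC ?_)⟩
    rcases n with _ | n
    · simp
    · rw [div_le_one (Real.sqrt_pos.mpr (by positivity)), Real.one_le_sqrt]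
      exact_mod_cast Nat.succ_le_succ n.zero_le

theorem summable_liCoeff {w : Word} (h : (0 :: w).getLast? ≠ some 0) :
    Summable (liCoeff (0 :: w)) := by
  have hw : w ≠ [] := by rintro rfl; simp at h
  obtain ⟨C, hC, hb⟩ := exists_liCoeff_le hw (getLast?_tail_ne h)
  have hs : Summable fun n : ℕ => C * (1 / (n : ℝ) ^ (3 / 2 : ℝ)) :=
    (Real.summable_one_div_nat_rpow.mpr (by norm_num)).mul_left C
  refine Summable.of_nonneg_of_le (liCoeff_nonneg _) (fun n => ?_) hs
  change liCoeff w n / n ≤ _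
  rcases n with _ | n
  · simp
  · have hn : (0 : ℝ) < (n + 1 : ℕ) := by positivity
    rw [div_le_iff₀ hn]
    refine (hb _).trans (le_of_eq ?_)
    rw [show (3 / 2 : ℝ) = 1 / 2 + 1 by norm_num, Real.rpow_add hn, Real.rpow_one,
      ← Real.sqrt_eq_rpow]
    have hs : Real.sqrt (n + 1 : ℕ) ≠ 0 := (Real.sqrt_pos.mpr hn).ne'
    field_simp

theorem powerSeries_differentiableAt_and_hasSum {a : ℕ → ℝ} {C : ℝ}
    (h0 : ∀ n, 0 ≤ a n) (hC : ∀ n, a n ≤ C)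
    {z : ℂ} (hz : ‖z‖ < 1) : DifferentiableAt ℂ (fun ζ => ∑' n, (a n : ℂ) * ζ ^ n) z ∧
      Summable (fun n => (a n : ℂ) * z ^ n) ∧
      HasSum (fun n : ℕ => (n : ℂ) * a n * z ^ n)
        (z * deriv (fun ζ => ∑' n, (a n : ℂ) * ζ ^ n) z) := by
  obtain ⟨r, hzr, hr1⟩ := exists_between hz
  have hr0 : 0 ≤ r := (norm_nonneg z).trans hzr.le
  have hu : Summable fun n : ℕ => C * r ^ n := (summable_geometric_of_lt_one hr0 hr1).mul_left C
  have hd : ∀ n : ℕ, DifferentiableOn ℂ (fun ζ : ℂ => (a n : ℂ) * ζ ^ n) (Metric.ball 0 r) :=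
    fun n => by fun_prop
  have hle : ∀ (n : ℕ) (ζ : ℂ), ζ ∈ Metric.ball (0 : ℂ) r → ‖(a n : ℂ) * ζ ^ n‖ ≤ C * r ^ n :=
    fun n ζ hζ => by
      rw [mem_ball_zero_iff] at hζ
      rw [norm_mul, norm_pow, Complex.norm_real, Real.norm_of_nonneg (h0 n)]
      have := (h0 n).trans (hC n)
      gcongr
      exact hC n
  have hzb : z ∈ Metric.ball (0 : ℂ) r := by rwa [mem_ball_zero_iff]
  refine ⟨(Complex.differentiableOn_tsum_of_summable_norm hu hd Metric.isOpen_ball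
    hle).differentiableAt (Metric.isOpen_ball.mem_nhds hzb),
    Summable.of_norm_bounded hu fun n => hle n z hzb, ?_⟩
  have h := (Complex.hasSum_deriv_of_summable_norm hu hd Metric.isOpen_ball hle hzb).mul_left z
  refine h.congr_fun fun n => ?_
  rw [deriv_const_mul_field, deriv_pow_field]
  rcases n with _ | n
  · simp
  · rw [Nat.add_sub_cancel, pow_succ]
    ring

/-- For words not ending in `0` the term `F X₀` drops out, and the equations `z f' = f_tail` or
`(1-z) f' = f_tail` are the recursion of `liCoeff`. -/
theorem polylog_eq_tsum {w : Word} (h : w.getLast? ≠ some 0) {z : ℂ} (hz : ‖z‖ < 1) :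
    polylog w z = ∑' n, (liCoeff w n : ℂ) * z ^ n := by
  induction w generalizing z with
  | nil =>
    rw [polylog_nil, tsum_eq_single 0 (fun n hn => by simp [liCoeff, hn])]
    simp [liCoeff]
  | cons a w ih =>
    have h' := getLast?_tail_ne h
    obtain ⟨C, -, hC⟩ := exists_liCoeff_le_const h
    obtain ⟨C', -, hC'⟩ := exists_liCoeff_le_const h'
    have hps := fun {z : ℂ} (hz : ‖z‖ < 1) =>
      powerSeries_differentiableAt_and_hasSum (liCoeff_nonneg (a :: w)) hC hz
    set g : ℂ → ℂ := fun ζ => ∑' n, (liCoeff (a :: w) n : ℂ) * ζ ^ n with hg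
    have hg0 : g 0 = 0 := by
      refine (tsum_congr fun n => ?_).trans tsum_zero
      rcases n with _ | n
      · rw [liCoeff_cons_zero]; simp
      · simp
    have hD0 : ∀ {z : ℂ}, z ∈ Metric.ball (0 : ℂ) 1 → z ∈ D0 := fun hz =>
      mem_D0_of_norm_lt_one (mem_ball_zero_iff.mp hz)
    have hd : ∀ z ∈ Metric.ball (0 : ℂ) 1, HasDerivAt (fun ζ => polylog (a :: w) ζ - g ζ)
        (polylogDeriv (a :: w) z - deriv g z) z := fun z hz =>
      (hasDerivAt_polylog _ (hD0 hz)).sub (hps (mem_ball_zero_iff.mp hz)).1.hasDerivAt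
    refine sub_eq_zero.mp (eq_zero_of_deriv_eq_zero (E := fun ζ => polylog (a :: w) ζ - g ζ)
      Metric.isOpen_ball (convex_ball (0 : ℂ) 1).isPreconnected (by simp)
      (fun z hz => (hd z hz).differentiableAt.differentiableWithinAt)
      (by rw [hg0, polylog_zero (by simp), sub_zero]) (fun z hz hz0 => ?_)
      (mem_ball_zero_iff.mpr hz))
    rw [(hd z hz).deriv, polylogDeriv_eq _ hz0, polylogComm, if_neg h, sub_zero, List.tail_cons,
      List.head?_cons]
    have hz1 := mem_ball_zero_iff.mp hz
    have hsum := (hps hz1).2.2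
    have hw := (powerSeries_differentiableAt_and_hasSum (liCoeff_nonneg w) hC' hz1).2.1.hasSum
    rw [← ih h' hz1] at hw
    have h1z := one_sub_ne_zero_of_mem_D0 (hD0 hz)
    rw [sub_eq_zero]
    fin_cases a
    · have hwne : w ≠ [] := by rintro rfl; simp at h
      have e : z * deriv g z = polylog w z := by
        refine hsum.unique (hw.congr_fun fun n => ?_)
        change _ * ((liCoeff w n / n : ℝ) : ℂ) * _ = _
        rcases n with _ | n
        · obtain ⟨b, v, rfl⟩ := List.exists_cons_of_ne_nil hwne
          rw [liCoeff_cons_zero]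
          simp
        · have : ((n + 1 : ℕ) : ℂ) ≠ 0 := by exact_mod_cast n.succ_ne_zero
          rw [Complex.ofReal_div, Complex.ofReal_natCast, mul_div_cancel₀ _ this]
      simp only [Fin.zero_eta, if_true, ← e]
      field_simp
      simp
    · have hA : HasSum (fun n : ℕ => ((∑ m ∈ Finset.range n, liCoeff w m : ℝ) : ℂ) * z ^ n)
          (z * deriv g z) := by
        refine hsum.congr_fun fun n => ?_
        change _ = _ * (((∑ m ∈ Finset.range n, liCoeff w m) / n : ℝ) : ℂ) * _
        rcases n with _ | n
        · simp
        · have : ((n + 1 : ℕ) : ℂ) ≠ 0 := by exact_mod_cast n.succ_ne_zero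
          rw [Complex.ofReal_div, Complex.ofReal_natCast, mul_div_cancel₀ _ this]
      have hA1 := (hasSum_nat_add_iff' 1).mpr hA
      rw [Finset.sum_range_one, Finset.sum_range_zero, Complex.ofReal_zero, zero_mul,
        sub_zero] at hA1
      -- Shifting the index in the series `A` of partial sums gives `A = z A + z f_w`, with `A = z
      -- g'`; dividing by `z` leaves `f_w = (1 - z) g'`.
      have hA2 : HasSum (fun n : ℕ => ((∑ m ∈ Finset.range (n + 1), liCoeff w m : ℝ) : ℂ) *
          z ^ (n + 1)) (z * (z * deriv g z) + z * polylog w z) :=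
        ((hA.mul_left z).add (hw.mul_left z)).congr_fun fun n => by
          rw [Finset.sum_range_succ, pow_succ]
          push_cast
          ring
      have e := hA1.unique hA2
      have e' : polylog w z = deriv g z * (1 - z) := by
        apply mul_left_cancel₀ hz0
        linear_combination -e
      simp [e', h1z]

/-! ### Multiple zeta values as sums of Taylor coefficients -/

/-- The term of a multiple zeta value. -/
noncomputable def mzvTerm (k : List ℕ) (n : Fin k.length → ℕ) : ℝ := ∏ i, 1 / (n i : ℝ) ^ k.get i

open Classical in
/-- The indices of a truncated multiple zeta value. -/
noncomputable def mzvBox (r N : ℕ) : Finset (Fin r → ℕ) :=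
  (Fintype.piFinset fun _ => Finset.range N).filter fun n => StrictAnti n ∧ ∀ i, 0 < n i

theorem mem_mzvBox {r N : ℕ} (n : Fin r → ℕ) :
    n ∈ mzvBox r N ↔ (∀ i, n i < N) ∧ StrictAnti n ∧ ∀ i, 0 < n i := by
  simp [mzvBox]

/-- The truncated multiple zeta value. -/
noncomputable def mzvTrunc (k : List ℕ) (N : ℕ) : ℝ := ∑ n ∈ mzvBox k.length N, mzvTerm k n

theorem mzvTrunc_nil (N : ℕ) : mzvTrunc [] N = 1 := by
  have : mzvBox 0 N = Finset.univ := by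
    ext n
    exact ⟨fun _ => Finset.mem_univ n, fun _ => (mem_mzvBox n).mpr
      ⟨fun i => i.elim0, fun i => i.elim0, fun i => i.elim0⟩⟩
  change ∑ n ∈ mzvBox 0 N, _ = _
  rw [this]
  simp [mzvTerm]

/-- Split off the largest index `m = n₁`; the remaining ones run below `m`. -/
theorem mzvTrunc_cons (k : ℕ) (hk : k ≠ 0) (ks : List ℕ) (N : ℕ) :
    mzvTrunc (k :: ks) N = ∑ m ∈ Finset.range N, mzvTrunc ks m / (m : ℝ) ^ k := by
  have h1 : ∑ m ∈ Finset.range N, mzvTrunc ks m / (m : ℝ) ^ k =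
      ∑ m ∈ (Finset.range N).filter (0 < ·), ∑ n ∈ mzvBox ks.length m,
        mzvTerm ks n / (m : ℝ) ^ k := by
    rw [Finset.sum_filter]
    refine Finset.sum_congr rfl fun m _ => ?_
    rcases m with _ | m
    -- The index `m = 0` is not admissible; its summand vanishes because `0 ^ k = 0` and division by
    -- zero gives `0`.
    · simp [hk]
    · rw [if_pos m.succ_pos, mzvTrunc, Finset.sum_div]
  rw [h1, Finset.sum_sigma']
  symm
  refine Finset.sum_bij' (fun p _ => (Fin.cons p.1 p.2 : Fin (ks.length + 1) → ℕ))
    (fun n _ => ⟨n 0, Fin.tail n⟩) ?_ ?_ ?_ ?_ ?_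
  · rintro ⟨m, n⟩ h
    rw [Finset.mem_sigma, Finset.mem_filter, Finset.mem_range, mem_mzvBox] at h
    obtain ⟨⟨hmN, hm⟩, hlt, hanti, hpos⟩ := h
    refine (mem_mzvBox _).mpr ⟨?_, ?_, ?_⟩
    · exact Fin.cases (by simpa using hmN) fun i => by simpa using (hlt i).trans hmN
    · intro i j
      refine Fin.cases ?_ (fun i => ?_) i <;> refine Fin.cases ?_ (fun j => ?_) j
      · simp
      · intro _; simpa using hlt j
      · intro h; exact absurd h (Fin.not_lt_zero _)
      · intro h
        simpa using hanti (Fin.succ_lt_succ_iff.mp h)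
    · exact Fin.cases (by simpa using hm) fun i => by simpa using hpos i
  · intro n h
    obtain ⟨hlt, hanti, hpos⟩ := (mem_mzvBox n).mp h
    rw [Finset.mem_sigma, Finset.mem_filter, Finset.mem_range, mem_mzvBox]
    exact ⟨⟨hlt 0, hpos 0⟩, fun i => hanti (Fin.succ_pos i),
      fun i j hij => hanti (Fin.succ_lt_succ_iff.mpr hij), fun i => hpos i.succ⟩
  · rintro ⟨m, n⟩ _
    simp
  · intro n _
    exact Fin.cons_self_tail n
  · rintro ⟨m, n⟩ _
    change _ = ∏ i : Fin (ks.length + 1), _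
    rw [Fin.prod_univ_succ, mzvTerm, div_eq_mul_one_div, mul_comm]
    rfl

/-- The Taylor coefficient at `n` collects the terms with largest index `n₁ = n`: a leading `0`
raises the exponent of `n`, a leading `1` opens a new index above the previous ones. -/
theorem exponents_eq_cons {w : Word} (hw : w ≠ []) (h : w.getLast? ≠ some 0) :
    ∃ k ks, k ≠ 0 ∧ exponents w = k :: ks ∧
      ∀ n : ℕ, liCoeff w n = mzvTrunc ks n / (n : ℝ) ^ k := by
  induction w with
  | nil => exact absurd rfl hw
  | cons a w ih =>
    fin_cases a
    · have hw' : w ≠ [] := by rintro rfl; simp at h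
      obtain ⟨k, ks, hk, he, hc⟩ := ih hw' (getLast?_tail_ne h)
      refine ⟨k + 1, ks, k.succ_ne_zero, ?_, fun n => ?_⟩
      · change (exponents w).modifyHead (· + 1) = _
        rw [he]
        rfl
      · change liCoeff w n / n = _
        rw [hc, div_div, pow_succ]
    · refine ⟨1, exponents w, one_ne_zero, rfl, fun n => ?_⟩
      change (∑ m ∈ Finset.range n, liCoeff w m) / n = _
      rw [pow_one]
      rcases n with _ | n
      · simp
      congr 1
      by_cases hw' : w = []
      · subst hw'
        rw [show exponents [] = [] from rfl, mzvTrunc_nil,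
          Finset.sum_eq_single 0 (fun m _ hm => by simp [liCoeff, hm]) (by simp)]
        simp [liCoeff]
      · obtain ⟨k, ks, hk, he, hc⟩ := ih hw' (getLast?_tail_ne h)
        rw [he, mzvTrunc_cons k hk]
        exact Finset.sum_congr rfl fun m _ => hc m

/-- The terms are nonnegative and every finite set of indices lies in some box, so the supremum of
the truncations is the unordered sum. -/
theorem mzv_eq_of_tendsto {k : List ℕ} {S : ℝ} (hS : Tendsto (mzvTrunc k) atTop (𝓝 S)) :
    mzv k = S := by
  have h0 : ∀ n, 0 ≤ mzvTerm k n := fun n => Finset.prod_nonneg fun i _ => by positivity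
  have hmono : Monotone (mzvTrunc k) := fun M N hMN => by
    refine Finset.sum_le_sum_of_subset_of_nonneg (fun n hn => ?_) fun n _ _ => h0 n
    rw [mem_mzvBox] at hn ⊢
    exact ⟨fun i => (hn.1 i).trans_le hMN, hn.2⟩
  have hle : ∀ N, mzvTrunc k N ≤ S := hmono.ge_of_tendsto hS
  have hbox : ∀ N, ∑ n ∈ (mzvBox k.length N).subtype
      (fun n => StrictAnti n ∧ ∀ i, 0 < n i), mzvTerm k n.1 = mzvTrunc k N := fun N => by
    rw [Finset.sum_subtype_of_mem (mzvTerm k) fun n hn => ((mem_mzvBox n).mp hn).2]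
    rfl
  have hsum : HasSum (fun n : {n : Fin k.length → ℕ // StrictAnti n ∧ ∀ i, 0 < n i} =>
      mzvTerm k n.1) S := by
    refine hasSum_of_isLUB_of_nonneg _ (fun n => h0 n.1) ⟨?_, fun b hb => ?_⟩
    · rintro _ ⟨s, rfl⟩
      obtain ⟨N, hN⟩ : ∃ N, ∀ n ∈ s, ∀ i, n.1 i < N := by
        refine ⟨s.sup (fun n => Finset.univ.sup n.1) + 1, fun n hn i => Nat.lt_succ_of_le ?_⟩
        exact (Finset.le_sup (f := n.1) (Finset.mem_univ i)).trans
          (Finset.le_sup (f := fun n : {n : Fin k.length → ℕ // StrictAnti n ∧ ∀ i, 0 < n i} =>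
            Finset.univ.sup n.1) hn)
      refine le_trans ?_ (hle N)
      rw [← hbox]
      refine Finset.sum_le_sum_of_subset_of_nonneg (fun n hn => ?_) fun n _ _ => h0 n.1
      rw [Finset.mem_subtype, mem_mzvBox]
      exact ⟨hN n hn, n.2⟩
    · refine le_of_tendsto hS (Eventually.of_forall fun N => ?_)
      rw [← hbox]
      exact hb ⟨_, rfl⟩
  rw [mzv, ← (Complex.hasSum_ofReal.mpr hsum).tsum_eq]
  refine tsum_congr fun n => ?_
  rw [mzvTerm]
  push_cast
  rfl

theorem mzv_exponents {w : Word} (h : (0 :: w).getLast? ≠ some 0) :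
    mzv (exponents (0 :: w)) = ∑' n, (liCoeff (0 :: w) n : ℂ) := by
  obtain ⟨k, ks, hk, he, hc⟩ := exponents_eq_cons (by simp) h
  rw [← Complex.ofReal_tsum]
  refine mzv_eq_of_tendsto ?_
  rw [he]
  refine (summable_liCoeff h).hasSum.tendsto_sum_nat.congr fun N => ?_
  rw [mzvTrunc_cons k hk]
  exact Finset.sum_congr rfl fun n _ => hc n

theorem mzv_nil : mzv [] = 1 := by
  rw [mzv_eq_of_tendsto (S := 1), Complex.ofReal_one]
  simp only [funext mzvTrunc_nil]
  exact tendsto_const_nhds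

/-! ### Limits at `1` -/

/-- Abel's limit theorem in its easy case: the Taylor coefficients are summable and dominate the
series on `(0, 1)`. -/
theorem tendsto_polylog_one {w : Word} (h : (0 :: w).getLast? ≠ some 0) :
    Tendsto (fun x : ℝ => polylog (0 :: w) x) (𝓝[<] 1) (𝓝 (mzv (exponents (0 :: w)))) := by
  have hx : ∀ᶠ x : ℝ in 𝓝[<] 1, x ∈ Set.Ioo (0 : ℝ) 1 := Ioo_mem_nhdsLT one_pos
  have hnorm : ∀ x ∈ Set.Ioo (0 : ℝ) 1, ‖(x : ℂ)‖ < 1 := fun x hx => by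
    rw [Complex.norm_real, Real.norm_of_nonneg hx.1.le]
    exact hx.2
  rw [mzv_exponents h]
  have ht : Tendsto (fun x : ℝ => ∑' n, (liCoeff (0 :: w) n : ℂ) * (x : ℂ) ^ n) (𝓝[<] 1)
      (𝓝 (∑' n, (liCoeff (0 :: w) n : ℂ))) := by
    refine tendsto_tsum_of_dominated_convergence (summable_liCoeff h) (fun n => ?_) ?_
    · have hc : Continuous fun x : ℝ => (liCoeff (0 :: w) n : ℂ) * (x : ℂ) ^ n := by fun_prop
      simpa using (hc.tendsto 1).mono_left nhdsWithin_le_nhds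
    · filter_upwards [hx] with x hx n
      rw [norm_mul, norm_pow, Complex.norm_real, Real.norm_of_nonneg (liCoeff_nonneg _ n)]
      exact mul_le_of_le_one_right (liCoeff_nonneg _ n)
        (pow_le_one₀ (norm_nonneg _) (hnorm x hx).le)
  refine ht.congr' ?_
  filter_upwards [hx] with x hx
  exact (polylog_eq_tsum h (hnorm x hx)).symm

theorem tendsto_pairing_zeta {f : Shuffle} (hf : f ∈ Shuffle.S10) :
    Tendsto (fun x : ℝ => pairing (polylogSeries x) f) (𝓝[<] 1) (𝓝 (zeta f)) := by
  refine Submodule.span_induction (p := fun f _ =>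
    Tendsto (fun x : ℝ => pairing (polylogSeries x) f) (𝓝[<] 1) (𝓝 (zeta f))) ?_ ?_
    (fun f g _ _ hf hg => ?_) (fun c f _ hf => ?_) hf
  · rintro _ ⟨w, hw, rfl⟩
    simp only [pairing_word, zeta, Shuffle.extend_word]
    rcases hw with rfl | ⟨u, rfl⟩
    · rw [show exponents [] = [] from rfl, mzv_nil]
      exact tendsto_const_nhds.congr fun x => (polylog_nil x).symm
    · refine tendsto_polylog_one ?_
      rw [← List.cons_append, List.getLast?_concat]
      simp
  · simp
  · simpa only [map_add] using hf.add hg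
  · simpa only [map_smul, smul_eq_mul] using hf.const_mul c

/-! ### Regularization of the first letters -/

/-- The coefficient of `ξ₁^j` is `(-log(1-z))^j / j!`, and its sign cancels the `(-1)^j` of
`regWith`; what remains is the exponential acting through `stripFirst 1`. -/
theorem pairing_polylogSeries_regWith (w : Word) {z : ℂ} (hz : z ∈ D0) :
    pairing (polylogSeries z) (Shuffle.regWith (Shuffle.stripFirst 1) 1 (Shuffle.word w)) =
      (exp (Complex.log (1 - z) • X 1) * polylogSeries z) w := by
  have hg := isGrouplike_polylogSeries hz
  rw [exp_smul_X_mul, Shuffle.regWith, Shuffle.extend_word, map_sum]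
  refine Finset.sum_congr rfl fun j _ => ?_
  rw [map_smul, hg.pairing_mul, pairing_word _ (List.replicate j 1), hg.apply_replicate,
    show polylogSeries z [1] = polylog [1] z from rfl, polylog_singleton_one hz, smul_eq_mul,
    neg_pow (Complex.log (1 - z))]
  have : (-1 : ℂ) ^ j * (-1) ^ j = 1 := by rw [← mul_pow]; simp
  linear_combination (pairing (polylogSeries z) ((Shuffle.stripFirst 1 ^ j) (Shuffle.word w)) *
    Complex.log (1 - z) ^ j / (j.factorial : ℂ)) * this

/-- The inner `reg0` has no effect: its terms with `j > 0` contain the factor `ξ₀^j`, which the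
multiplicative map `regWith (stripFirst 1) 1` fixes and the series annihilates. -/
theorem pairing_polylogSeries_reg10 (w : Word) {z : ℂ} (hz : z ∈ D0) :
    pairing (polylogSeries z) (Shuffle.reg10 (Shuffle.word w)) =
      (exp (Complex.log (1 - z) • X 1) * polylogSeries z) w := by
  have hg := isGrouplike_polylogSeries hz
  have hD := Shuffle.isSlice_stripFirst 1
  have e : Shuffle.reg0 (Shuffle.word w) = ∑ j ∈ Finset.range (w.length + 1), (-1 : ℂ) ^ j •
      ((Shuffle.stripLast 0 ^ j) (Shuffle.word w) * Shuffle.word (List.replicate j 0)) := by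
    rw [Shuffle.reg0, Shuffle.regWith, Shuffle.extend_word]
  rw [← pairing_polylogSeries_regWith w hz, Shuffle.reg10, LinearMap.comp_apply, e, map_sum,
    map_sum, Finset.sum_eq_single 0]
  · rw [pow_zero, pow_zero, one_smul, Module.End.one_apply, List.replicate_zero,
      ← Shuffle.one_def, mul_one]
  · intro j _ hj
    have h0 : Shuffle.stripFirst 1 (Shuffle.word (List.replicate j 0)) = 0 := by
      cases j <;> simp [Shuffle.stripFirst, List.replicate_succ]
    have h1 := hD.regWith_mul_replicate h0 0
    rw [if_pos rfl, List.replicate_zero, ← Shuffle.one_def, mul_one] at h1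
    rw [map_smul, map_smul, hD.regWith_mul, hg.pairing_mul, h1, pairing_word, hg.apply_replicate,
      show polylogSeries z [0] = polylog [0] z from rfl, polylog_singleton_zero hz, zero_pow hj,
      zero_div, mul_zero, smul_zero]
  · simp

theorem reg10_mem (f : Shuffle) : Shuffle.reg10 f ∈ Shuffle.S10 := by
  obtain ⟨_, _, c, hc, -, h⟩ := (Shuffle.reg10_eq_iff f _).mp rfl
  rw [h]
  exact hc 0 0

/-! ### The connection between the two solutions -/

/-- Coefficientwise convergence as a real variable increases to `1`. -/
def TendstoAtOne (F : ℝ → NCSeries ℂ) (G : NCSeries ℂ) : Prop :=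
  ∀ w, Tendsto (fun x => F x w) (𝓝[<] 1) (𝓝 (G w))

theorem TendstoAtOne.mul {F G : ℝ → NCSeries ℂ} {A B : NCSeries ℂ} (hF : TendstoAtOne F A)
    (hG : TendstoAtOne G B) : TendstoAtOne (fun x => F x * G x) (A * B) := fun w =>
  tendsto_finsetSum _ fun i _ => (hF (w.take i)).mul (hG (w.drop i))

theorem TendstoAtOne.unique {F G : ℝ → NCSeries ℂ} {A B : NCSeries ℂ} (hF : TendstoAtOne F A)
    (hG : TendstoAtOne G B) (h : ∀ x ∈ Set.Ioo (0 : ℝ) 1, F x = G x) : A = B :=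
  ext fun w => by
    refine tendsto_nhds_unique (hF w) ((hG w).congr' ?_)
    filter_upwards [Ioo_mem_nhdsLT (one_pos : (0 : ℝ) < 1)] with x hx
    rw [h x hx]

/-- Coefficientwise decay faster than any power of the logarithm at `1`. -/
def NegligibleAtOne (F : ℝ → NCSeries ℂ) : Prop := ∀ (n : ℕ) (w : Word),
  Tendsto (fun x : ℝ => Complex.log (1 - x) ^ n * F x w) (𝓝[<] 1) (𝓝 0)

/-- A coefficient of the exponential is a monomial in `log(1-x)` or zero, so it only raises the
power of the logarithm. -/
theorem tendsto_log_pow_exp_smul_X_mul (ε : ℂ) (a : Fin 2) (u : Word) {n : ℕ} {f : ℝ → ℂ}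
    (hf : ∀ n : ℕ, Tendsto (fun x : ℝ => Complex.log (1 - x) ^ n * f x) (𝓝[<] 1) (𝓝 0)) :
    Tendsto (fun x : ℝ => Complex.log (1 - x) ^ n *
      (exp ((ε * Complex.log (1 - x)) • X a) u * f x)) (𝓝[<] 1) (𝓝 0) := by
  simp only [exp_smul_X]
  by_cases hu : u = List.replicate u.length a
  · simp only [if_pos hu]
    have h := (hf (n + u.length)).const_mul (ε ^ u.length / (u.length.factorial : ℂ))
    rw [mul_zero] at h
    refine h.congr fun x => ?_
    rw [mul_pow, pow_add]
    ring
  · simp only [if_neg hu, zero_mul, mul_zero]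
    exact tendsto_const_nhds

theorem NegligibleAtOne.exp_mul {F : ℝ → NCSeries ℂ} (hF : NegligibleAtOne F) (ε : ℂ) (a : Fin 2) :
    NegligibleAtOne fun x => exp ((ε * Complex.log (1 - x)) • X a) * F x := fun n w => by
  simp only [mul_apply, Finset.mul_sum]
  rw [← Finset.sum_const_zero (s := Finset.range (w.length + 1))]
  exact tendsto_finsetSum _ fun i _ =>
    tendsto_log_pow_exp_smul_X_mul ε a (w.take i) fun n => hF n (w.drop i)

theorem NegligibleAtOne.mul_exp {F : ℝ → NCSeries ℂ} (hF : NegligibleAtOne F) (ε : ℂ) (a : Fin 2) :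
    NegligibleAtOne fun x => F x * exp ((ε * Complex.log (1 - x)) • X a) := fun n w => by
  simp only [mul_apply, Finset.mul_sum, mul_comm (F _ _)]
  rw [← Finset.sum_const_zero (s := Finset.range (w.length + 1))]
  exact tendsto_finsetSum _ fun i _ =>
    tendsto_log_pow_exp_smul_X_mul ε a (w.drop i) fun n => hF n (w.take i)

/-- A polylogarithm of a nonempty word is `O(y)` at `0`, which beats any power of `log y`. -/
theorem tendsto_log_pow_mul_polylog {w : Word} (hw : w ≠ []) (n : ℕ) :
    Tendsto (fun y : ℂ => Complex.log y ^ n * polylog w y) (𝓝[≠] 0) (𝓝 0) := by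
  have h1 : (polylog w) =O[𝓝 0] fun y => y := by
    have := (hasDerivAt_polylog w zero_mem_D0).isBigO_sub
    simpa [polylog_zero hw] using this
  have h2 : Tendsto (fun y : ℂ => Complex.log y ^ n * y) (𝓝[≠] 0) (𝓝 0) := by
    -- Substitute `1/y`. Inversion changes the principal logarithm by a sign, up to conjugation on
    -- the cut, so its norm is preserved.
    have h3 := (tendsto_log_pow_div n).comp tendsto_inv₀_nhdsNE_zero
    have h4 : ∀ᶠ y : ℂ in 𝓝[≠] 0, ‖Complex.log y ^ n * y‖ ≤
        (1 + ‖Complex.log y⁻¹‖) ^ n / ‖y⁻¹‖ := by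
      refine Eventually.of_forall fun y => ?_
      rw [norm_inv, div_inv_eq_mul, norm_mul, norm_pow, Complex.log_inv_eq_ite]
      gcongr
      split_ifs <;> simp
    exact squeeze_zero_norm' h4 h3
  refine (Asymptotics.IsBigO.trans_tendsto ?_ h2)
  exact (Asymptotics.isBigO_refl _ _).mul (h1.mono nhdsWithin_le_nhds)

theorem tendsto_one_sub_nhdsLT_one :
    Tendsto (fun x : ℝ => 1 - (x : ℂ)) (𝓝[<] 1) (𝓝[≠] 0) := by
  refine tendsto_nhdsWithin_iff.mpr ⟨?_, ?_⟩
  · have hc : Continuous fun x : ℝ => 1 - (x : ℂ) := by fun_prop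
    simpa using (hc.tendsto 1).mono_left nhdsWithin_le_nhds
  · filter_upwards [self_mem_nhdsWithin] with x hx h
    have h' : (x : ℂ) = 1 := (sub_eq_zero.mp h).symm
    exact hx.ne (by exact_mod_cast h')

theorem negligibleAtOne_dualPolylogSeries_sub_one :
    NegligibleAtOne fun x => dualPolylogSeries x - 1 := fun n w => by
  by_cases hw : w = []
  · subst hw
    refine tendsto_const_nhds.congr fun x => ?_
    beta_reduce
    rw [NCSeries.sub_apply, one_apply, if_pos rfl, dualPolylogSeries, negFlip]
    change _ = _ * ((-1) ^ 0 * polylog [] _ - 1)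
    rw [polylog_nil]
    simp
  · have hw' : flipWord w ≠ [] := by simpa [flipWord] using hw
    have h := ((tendsto_log_pow_mul_polylog hw' n).comp tendsto_one_sub_nhdsLT_one).const_mul
      ((-1 : ℂ) ^ w.length)
    rw [mul_zero] at h
    refine h.congr fun x => ?_
    beta_reduce
    rw [NCSeries.sub_apply, one_apply, if_neg hw, dualPolylogSeries, negFlip, sub_zero]
    simp only [Function.comp]
    rw [mul_left_comm]
    rfl

/-- `C` is chosen so that both sides agree at `1/2`; as solutions of the KZ equation they then agree
on all of the connected set `D0 ∩ D1`. -/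
theorem exists_connection : ∃ C : NCSeries ℂ, ∀ z ∈ D0 ∩ D1,
    polylogSeries z * powX0 z = dualPolylogSeries z * powNegX1 z * C := by
  set p : ℂ := ((1 / 2 : ℝ) : ℂ)
  have hp : p ∈ D0 ∩ D1 := half_mem
  have hu : IsUnit (dualPolylogSeries p * powNegX1 p) :=
    (isUnit_of_nil (isGrouplike_dualPolylogSeries hp.2).1).mul
      (isUnit_of_nil (exp_smul_X_nil _ _))
  refine ⟨Ring.inverse (dualPolylogSeries p * powNegX1 p) * (polylogSeries p * powX0 p),
    fun z hz => ?_⟩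
  refine isKZSolution_polylogSeries.eqOn (isKZSolution_dualPolylogSeries.mul_const _) hp ?_ hz
  rw [Ring.mul_inverse_cancel_left _ _ hu]

theorem ofReal_mem {x : ℝ} (hx : x ∈ Set.Ioo (0 : ℝ) 1) : (x : ℂ) ∈ D0 ∩ D1 := by
  rw [Set.mem_inter_iff, mem_D0_iff, mem_D1_iff]
  refine ⟨Or.inl ?_, Or.inl ?_⟩
  · simpa using hx.2
  · simpa using hx.1

theorem tendstoAtOne_PhiKZ :
    TendstoAtOne (fun x => exp (Complex.log (1 - x) • X 1) * polylogSeries x) PhiKZ := fun w => by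
  refine (tendsto_pairing_zeta (reg10_mem (Shuffle.word w))).congr' ?_
  filter_upwards [Ioo_mem_nhdsLT (one_pos : (0 : ℝ) < 1)] with x hx
  exact pairing_polylogSeries_reg10 w (ofReal_mem hx).1

theorem tendstoAtOne_powX0 : TendstoAtOne (fun x => powX0 x) 1 := fun w => by
  have hl : Tendsto (fun x : ℝ => Complex.log x) (𝓝[<] 1) (𝓝 0) := by
    have hc : ContinuousAt (fun x : ℝ => Complex.log x) 1 :=
      Complex.continuous_ofReal.continuousAt.clog (by simp)
    simpa using hc.tendsto.mono_left nhdsWithin_le_nhds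
  simp only [powX0, exp_smul_X, one_apply]
  by_cases hw : w = List.replicate w.length 0
  · simp only [if_pos hw]
    have h := (hl.pow w.length).div_const (w.length.factorial : ℂ)
    convert h using 2
    rcases w with _ | ⟨a, w⟩ <;> simp
  · rw [if_neg (by rintro rfl; exact hw rfl)]
    simp only [if_neg hw]
    exact tendsto_const_nhds

/-- Write the series as `1` plus a negligible part. Conjugation by `(1-x)^{X₁}` fixes `1`, and
multiplies the rest only by powers of the logarithm, which its decay absorbs. -/
theorem tendstoAtOne_conj_dualPolylogSeries : TendstoAtOne (fun x =>
    exp (Complex.log (1 - x) • X 1) * (dualPolylogSeries x * powNegX1 x)) 1 := fun w => by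
  have h := (negligibleAtOne_dualPolylogSeries_sub_one.mul_exp (-1) 1).exp_mul 1 1 0 w
  have h1 := h.add_const ((1 : NCSeries ℂ) w)
  rw [zero_add] at h1
  refine h1.congr fun x => ?_
  beta_reduce
  rw [pow_zero, one_mul, one_mul, neg_one_mul, ← NCSeries.add_apply, sub_mul, one_mul, mul_sub,
    exp_smul_X_mul_neg, sub_add_cancel]
  rfl

/-- Multiply the connection formula by `(1-x)^{X₁}` on the left and let `x` increase to `1`: the
left side tends to `PhiKZ * 1`, the right side to `1 * C`. -/
theorem polylogSeries_eq {z : ℂ} (hz : z ∈ D0 ∩ D1) :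
    polylogSeries z * powX0 z = dualPolylogSeries z * powNegX1 z * PhiKZ := by
  obtain ⟨C, hC⟩ := exists_connection
  have e : PhiKZ * 1 = 1 * C := by
    refine (tendstoAtOne_PhiKZ.mul tendstoAtOne_powX0).unique
      (tendstoAtOne_conj_dualPolylogSeries.mul (B := C) fun w => tendsto_const_nhds)
      fun x hx => ?_
    rw [mul_assoc, mul_assoc, hC x (ofReal_mem hx)]
  rw [mul_one, one_mul] at e
  rw [e, hC z hz]

/-! ### The main theorem -/

theorem isRHSolution_polylogSeries : IsRHSolution polylogSeries dualPolylogSeries where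
  form0 z hz := (isGrouplike_polylogSeries hz).hasRegForm (polylog_singleton_zero hz) _
  form1 z hz := (isGrouplike_dualPolylogSeries hz).hasRegForm (dualPolylogSeries_singleton hz) _
  holo0 := holomorphicOn_polylogSeries
  holo1 := holomorphicOn_dualPolylogSeries
  grouplike0 z hz := isGrouplike_polylogSeries hz
  grouplike1 z hz := isGrouplike_dualPolylogSeries hz
  rel z hz := by
    have hu := isUnit_of_nil (isGrouplike_dualPolylogSeries hz.2).1
    have h : polylogSeries z = dualPolylogSeries z * (powNegX1 z * PhiKZ * powNegX0 z) := by
      rw [← mul_assoc, ← mul_assoc, ← polylogSeries_eq hz, mul_assoc, powX0, powNegX0,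
        exp_smul_X_mul_neg, mul_one]
    rw [h, Ring.inverse_mul_cancel_left _ _ hu]
  asymp0 := derivTendstoZero_polylogSeries
  asymp1 := derivTendstoZero_dualPolylogSeries
  norm0 := polylogSeries_zero

theorem isFundamentalSolutionAtZero_polylogSeries :
    IsFundamentalSolutionAtZero fun z => polylogSeries z * powX0 z :=
  ⟨isKZSolution_polylogSeries, polylogSeries, fun w =>
    (holomorphicOn_polylogSeries w).analyticAt D0_mem_nhds, polylogSeries_zero, fun _ _ => rfl⟩

theorem isFundamentalSolutionAtOne_dualPolylogSeries :
    IsFundamentalSolutionAtOne fun z => dualPolylogSeries z * powNegX1 z :=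
  ⟨isKZSolution_dualPolylogSeries, dualPolylogSeries, fun w =>
    (holomorphicOn_dualPolylogSeries w).analyticAt
      (isOpen_D1.mem_nhds (mem_D1_of_re_pos (by simp))), dualPolylogSeries_one, fun _ _ => rfl⟩

theorem IsKZSolution.congr {G H : ℂ → NCSeries ℂ} (hG : IsKZSolution G)
    (h : ∀ z ∈ D0 ∩ D1, H z = G z) : IsKZSolution H := fun z hz w => by
  rw [h z hz]
  refine (hG z hz w).congr_of_eventuallyEq ?_
  filter_upwards [(isOpen_D0.inter isOpen_D1).mem_nhds hz] with y hy
  rw [h y hy]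

end KZ

theorem mainTheorem2
    (hdual : KZ.PhiKZ = Ring.inverse (KZ.NCSeries.subst
      ![-KZ.NCSeries.X 1, -KZ.NCSeries.X 0] KZ.PhiKZ)) :
    (∃ F0 F1 : ℂ → KZ.NCSeries ℂ, KZ.IsRHSolution F0 F1) ∧
    (∀ F0 F1 G0 G1 : ℂ → KZ.NCSeries ℂ, KZ.IsRHSolution F0 F1 → KZ.IsRHSolution G0 G1 →
      Set.EqOn F0 G0 KZ.D0 ∧ Set.EqOn F1 G1 KZ.D1) ∧
    (∀ F0 F1 : ℂ → KZ.NCSeries ℂ, KZ.IsRHSolution F0 F1 →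
      KZ.IsFundamentalSolutionAtZero (fun z => F0 z * KZ.powX0 z) ∧
      KZ.IsFundamentalSolutionAtOne (fun z => F1 z * KZ.powNegX1 z)) := by
  refine ⟨⟨_, _, KZ.isRHSolution_polylogSeries⟩, fun F0 F1 G0 G1 hF hG => hF.eqOn hG,
    fun F0 F1 hF => ?_⟩
  -- By uniqueness any solution agrees with the explicit one on `D0` and `D1`, hence on `D0 ∩ D1`,
  -- where the fundamental solutions are tested. The local factor `H` is taken from the explicit
  -- solution.
  obtain ⟨h0, h1⟩ := hF.eqOn KZ.isRHSolution_polylogSeries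
  obtain ⟨k0, H0, a0, b0, e0⟩ := KZ.isFundamentalSolutionAtZero_polylogSeries
  obtain ⟨k1, H1, a1, b1, e1⟩ := KZ.isFundamentalSolutionAtOne_dualPolylogSeries
  have c0 : ∀ z ∈ KZ.D0 ∩ KZ.D1, F0 z * KZ.powX0 z = KZ.polylogSeries z * KZ.powX0 z :=
    fun z hz => by rw [h0 hz.1]
  have c1 : ∀ z ∈ KZ.D0 ∩ KZ.D1, F1 z * KZ.powNegX1 z = KZ.dualPolylogSeries z * KZ.powNegX1 z :=
    fun z hz => by rw [h1 hz.2]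
  exact ⟨⟨k0.congr c0, H0, a0, b0, fun z hz => (c0 z hz).trans (e0 z hz)⟩,
    ⟨k1.congr c1, H1, a1, b1, fun z hz => (c1 z hz).trans (e1 z hz)⟩⟩
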